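/- Let $G$ be a compact simple Lie group, i.e. a compact Lie group whose Lie algebra $\mathfrak g$ is simple, let $\langle\cdot,\cdot\rangle$ be an inner product on $\mathfrak g$ invariant under the adjoint representation of $G$, let $k\neq 0$ be a real number, and let $\theta_L$ be the left-invariant Maurer–Cartan form. Then there is a 3-form $\nu_k$ on $G$ with $$\nu_k(u,v,w)=k\,\langle\theta_L(u),[\theta_L(v),\theta_L(w)]\rangle$$ for tangent vectors $u,v,w$ at any point of $G$, and it is a 2-plectic structure: smooth, closed, and nondegenerate ($\iota_v\nu_k=0$ implies $v=0$). Call a smooth 1-form $\alpha$ *Hamiltonian* if there is a smooth vector field $v_\alpha$ with $d\alpha=-\iota_{v_\alpha}\nu_k$. The following hold. 1. Every left-invariant smooth 1-form on $G$ is Hamiltonian. 2. There is a unique Lie 2-algebra $\mathfrak g_k$ (the string Lie 2-algebra) with space of 0-chains $\mathfrak g$, space of 1-chains $\mathbb R$, zero differential, bracket equal to the Lie bracket of $\mathfrak g$ in degree 0 and trivial otherwise, and Jacobiator $J(x,y,z)=k\langle x,[y,z]\rangle$. 3. There is a unique Lie 2-algebra $\mathrm{Lie}(G,\nu_k)^L$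 whose 0-chains are the left-invariant Hamiltonian 1-forms, whose 1-chains are the left-invariant smooth functions, whose differential is the de Rham differential, whose bracket is $\{\alpha,\beta\}=\nu_k(v_\alpha,v_\beta,\cdot)$ in degree 0 and trivial otherwise, and whose Jacobiator is $J(\alpha,\beta,\gamma)=-\nu_k(v_\alpha,v_\beta,v_\gamma)$. 4. The Lie 2-algebras $\mathfrak g_k$ and $\mathrm{Lie}(G,\nu_k)^L$ are isomorphic. Here a Lie 2-algebra is a two-term chain complex of real vector spaces $d:L_1\to L_0$ with a skew-symmetric chain map $[\cdot,\cdot]:L\otimes L\to L$ and a skew-symmetric chain homotopy $J:L^{\otimes 3}\to L$ (the Jacobiator) from $[x,[y,z]]$ to $[[x,y],z]+[y,[x,z]]$ such that $$[x,J(y,z,w)]+J(x,[y,z],w)+J(x,z,[y,w])+[J(x,y,z),w]+[z,J(x,y,w)]$$ $$=J(x,y,[z,w])+J([x,y],z,w)+[y,J(x,z,w)]+J(y,[x,z],w)+J(y,z,[x,w]).$$ A morphism $L\to L'$ is a chain map $\phi$ with a skew-symmetric chain homotopy $\Phi:L\otimes L\to L'$ from $\phi([x,y])$ to $[\phi(x),\phi(y)]'$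 such that $$\phi_1(J(x,y,z))-J'(\phi_0x,\phi_0y,\phi_0z)=\Phi(x,[y,z])-\Phi([x,y],z)-\Phi(y,[x,z])$$ $$-[\Phi(x,y),\phi_0z]'+[\phi_0x,\Phi(y,z)]'-[\phi_0y,\Phi(x,z)]',$$ the composite of $(\phi,\Phi):L\to L'$ and $(\psi,\Psi):L'\to L''$ is $\psi\circ\phi$ with homotopy $\Psi(\phi_0x,\phi_0y)+\psi_1\Phi(x,y)$, and an isomorphism is a morphism with a two-sided inverse. A chain homotopy $h$ from $f$ to $g$ satisfies $dh+hd=f-g$. -/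

import Mathlib

open Set
open scoped Manifold ContDiff Topology

/-! ### Lie 2-algebras -/

/-- A Lie 2-algebra on the two-term complex `d : L₁ → L₀` of real vector spaces.
The skew-symmetric chain map `[·,·] : L ⊗ L → L` has a component `L₀ ⊗ L₀ → L₀` (`bracket`) and a
component `L₀ ⊗ L₁ → L₁` (`act`); the component `L₁ ⊗ L₀ → L₁` is `[a, x] = -[x, a]`, and
`L₁ ⊗ L₁ → L₂ = 0` vanishes. `J` is the Jacobiator. A chain homotopy `h` from `f` to `g` means
`d h + h d = f - g`. -/
@[ext]
structure Lie2Algebra (L₁ L₀ : Type*) [AddCommGroup L₁] [Module ℝ L₁]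
    [AddCommGroup L₀] [Module ℝ L₀] where
  d : L₁ →ₗ[ℝ] L₀
  bracket : L₀ →ₗ[ℝ] L₀ →ₗ[ℝ] L₀
  act : L₀ →ₗ[ℝ] L₁ →ₗ[ℝ] L₁
  J : L₀ →ₗ[ℝ] L₀ →ₗ[ℝ] L₀ →ₗ[ℝ] L₁
  /-- The bracket is skew-symmetric in degree 0. -/
  bracket_skew : ∀ x y, bracket x y = -bracket y x
  /-- The bracket is a chain map in degree 1: `d [x, a] = [x, d a]`. -/
  d_act : ∀ x a, d (act x a) = bracket x (d a)
  /-- The bracket is a chain map in degree 2: `[d a, b] = [a, d b]`. -/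
  act_d : ∀ a b, act (d a) b = -act (d b) a
  /-- The Jacobiator is totally skew-symmetric. -/
  J_swap_left : ∀ x y z, J x y z = -J y x z
  J_swap_right : ∀ x y z, J x y z = -J x z y
  /-- The Jacobiator is a chain homotopy from `[x,[y,z]]` to `[[x,y],z] + [y,[x,z]]`, degree 0. -/
  d_J : ∀ x y z, d (J x y z) =
    bracket x (bracket y z) - (bracket (bracket x y) z + bracket y (bracket x z))
  /-- The same in degree 1. -/
  J_d : ∀ x y a, J x y (d a) = act x (act y a) - (act (bracket x y) a + act y (act x a))
  /-- The coherence law of the Jacobiator. -/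
  coherence : ∀ x y z w,
    act x (J y z w) + J x (bracket y z) w + J x z (bracket y w) - act w (J x y z)
        + act z (J x y w) =
      J x y (bracket z w) + J (bracket x y) z w + act y (J x z w) + J y (bracket x z) w
        + J y z (bracket x w)

namespace Lie2Algebra

variable {L₁ L₀ M₁ M₀ N₁ N₀ : Type*}
  [AddCommGroup L₁] [Module ℝ L₁] [AddCommGroup L₀] [Module ℝ L₀]
  [AddCommGroup M₁] [Module ℝ M₁] [AddCommGroup M₀] [Module ℝ M₀]
  [AddCommGroup N₁] [Module ℝ N₁] [AddCommGroup N₀] [Module ℝ N₀]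

/-- A morphism of Lie 2-algebras: a chain map `(φ₀, φ₁)` and a skew-symmetric chain homotopy `Φ`
from `φ [x, y]` to `[φ x, φ y]`, compatible with the Jacobiators. -/
@[ext]
structure Hom (L : Lie2Algebra L₁ L₀) (M : Lie2Algebra M₁ M₀) where
  φ₀ : L₀ →ₗ[ℝ] M₀
  φ₁ : L₁ →ₗ[ℝ] M₁
  Φ : L₀ →ₗ[ℝ] L₀ →ₗ[ℝ] M₁
  φ_d : ∀ a, φ₀ (L.d a) = M.d (φ₁ a)
  Φ_skew : ∀ x y, Φ x y = -Φ y x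
  d_Φ : ∀ x y, M.d (Φ x y) = φ₀ (L.bracket x y) - M.bracket (φ₀ x) (φ₀ y)
  Φ_d : ∀ x a, Φ x (L.d a) = φ₁ (L.act x a) - M.act (φ₀ x) (φ₁ a)
  coherence : ∀ x y z, φ₁ (L.J x y z) - M.J (φ₀ x) (φ₀ y) (φ₀ z) =
    Φ x (L.bracket y z) - Φ (L.bracket x y) z - Φ y (L.bracket x z)
      + M.act (φ₀ z) (Φ x y) + M.act (φ₀ x) (Φ y z) - M.act (φ₀ y) (Φ x z)

/-- The identity morphism. -/
def Hom.id (L : Lie2Algebra L₁ L₀) : Hom L L where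
  φ₀ := LinearMap.id
  φ₁ := LinearMap.id
  Φ := 0
  φ_d := by simp
  Φ_skew := by simp
  d_Φ := by simp
  Φ_d := by simp
  coherence := by simp

/-- Composition of morphisms: the chain homotopy of `G ∘ F` is `Ψ (φ₀ x, φ₀ y) + ψ₁ (Φ (x, y))`. -/
def Hom.comp {L : Lie2Algebra L₁ L₀} {M : Lie2Algebra M₁ M₀} {N : Lie2Algebra N₁ N₀}
    (G : Hom M N) (F : Hom L M) : Hom L N where
  φ₀ := G.φ₀ ∘ₗ F.φ₀
  φ₁ := G.φ₁ ∘ₗ F.φ₁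
  Φ := G.Φ.compl₁₂ F.φ₀ F.φ₀ + F.Φ.compr₂ G.φ₁
  φ_d a := by simp [F.φ_d, G.φ_d]
  Φ_skew x y := by
    simp only [LinearMap.add_apply, LinearMap.compl₁₂_apply, LinearMap.compr₂_apply]
    rw [G.Φ_skew, F.Φ_skew x y, map_neg]; abel
  d_Φ x y := by
    simp only [LinearMap.add_apply, LinearMap.compl₁₂_apply, LinearMap.compr₂_apply,
      LinearMap.comp_apply, map_add, G.d_Φ, ← G.φ_d, F.d_Φ, map_sub]
    abel
  Φ_d x a := by
    simp only [LinearMap.add_apply, LinearMap.compl₁₂_apply, LinearMap.compr₂_apply,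
      LinearMap.comp_apply, F.φ_d, G.Φ_d, F.Φ_d, map_sub]
    abel
  coherence x y z := by
    have hF := congrArg G.φ₁ (F.coherence x y z)
    have hG := G.coherence (F.φ₀ x) (F.φ₀ y) (F.φ₀ z)
    have e : ∀ u v, F.φ₀ (L.bracket u v) = M.d (F.Φ u v) + M.bracket (F.φ₀ u) (F.φ₀ v) := by
      intro u v; rw [F.d_Φ]; abel
    have k : ∀ u b, G.φ₁ (M.act u b) = G.Φ u (M.d b) + N.act (G.φ₀ u) (G.φ₁ b) := by
      intro u b; rw [G.Φ_d]; abel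
    have s : ∀ b u, G.Φ (M.d b) u = -G.Φ u (M.d b) := fun b u => G.Φ_skew _ _
    simp only [map_add, map_sub, k] at hF
    simp only [LinearMap.add_apply, LinearMap.compl₁₂_apply, LinearMap.compr₂_apply,
      LinearMap.comp_apply, map_add, e, s]
    rw [← sub_eq_zero] at hF hG ⊢
    rw [← add_zero (0 : N₁)]
    nth_rewrite 1 [← hF]
    rw [← hG]
    abel

/-- Two Lie 2-algebras are isomorphic if there is an invertible morphism between them. -/
def Isomorphic (L : Lie2Algebra L₁ L₀) (M : Lie2Algebra M₁ M₀) : Prop :=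
  ∃ (F : Hom L M) (G : Hom M L), G.comp F = Hom.id L ∧ F.comp G = Hom.id M

end Lie2Algebra

/-! ### Differential forms on manifolds -/

section Forms

variable {E : Type*} [NormedAddCommGroup E] [NormedSpace ℝ E]
  {H : Type*} [TopologicalSpace H] (I : ModelWithCorners ℝ E H)
  (M : Type*) [TopologicalSpace M] [ChartedSpace H M]

/-- Not necessarily smooth differential `k`-forms: a `k`-linear alternating form on each tangent
space. -/
abbrev RoughForm (k : ℕ) : Type _ := ∀ x : M, TangentSpace I x [⋀^Fin k]→L[ℝ] ℝ

variable {I M}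

/-- The derivative of the preferred chart at `x`, as a map from `T_x M` to the model space. -/
noncomputable def chartDeriv (x : M) : TangentSpace I x →L[ℝ] E :=
  mfderiv I 𝓘(ℝ, E) (extChartAt I x) x

/-- The derivative at `y` of the inverse of the preferred chart at `x₀`. -/
noncomputable def chartSymmDeriv (x₀ : M) (y : E) :
    E →L[ℝ] TangentSpace I ((extChartAt I x₀).symm y) :=
  mfderivWithin 𝓘(ℝ, E) I (extChartAt I x₀).symm (range I) y

/-- The coordinate expression of a form in the preferred chart at `x₀`: its pullback along the
inverse of this chart, a form on (a subset of) the model space `E`. -/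
noncomputable def RoughForm.inChart {k : ℕ} (σ : RoughForm I M k) (x₀ : M) (y : E) :
    E [⋀^Fin k]→L[ℝ] ℝ :=
  (σ ((extChartAt I x₀).symm y)).compContinuousLinearMap (chartSymmDeriv x₀ y)

/-- A form is smooth if all its coordinate expressions are. -/
def RoughForm.IsSmooth {k : ℕ} (σ : RoughForm I M k) : Prop :=
  ∀ x₀ : M, ContDiffOn ℝ ∞ (σ.inChart x₀) (extChartAt I x₀).target

/-- The exterior derivative of a form, computed at `x` in the preferred chart at `x`. -/
noncomputable def RoughForm.extDeriv {k : ℕ} (σ : RoughForm I M k) : RoughForm I M (k + 1) :=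
  fun x => (extDerivWithin (σ.inChart x) (range I) (extChartAt I x x)).compContinuousLinearMap
    (chartDeriv x)

/-- The differential of a function, as a `1`-form. -/
noncomputable def RoughForm.ofFunction (f : M → ℝ) : RoughForm I M 1 :=
  fun x => ContinuousAlternatingMap.ofSubsingleton ℝ (TangentSpace I x) ℝ (0 : Fin 1)
    (mfderiv I 𝓘(ℝ, ℝ) f x)

/-- A `2`-plectic structure: a smooth closed nondegenerate `3`-form. -/
structure IsTwoPlectic (σ : RoughForm I M 3) : Prop where
  smooth : σ.IsSmooth
  closed : σ.extDeriv = 0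
  nondegenerate : ∀ (x : M) (v : TangentSpace I x), (∀ u w, σ x ![v, u, w] = 0) → v = 0

/-- `V` is a Hamiltonian vector field of the `1`-form `α`: it is smooth and `dα = -ι_V σ`. -/
def IsHamiltonianVectorField [IsManifold I 1 M] (σ : RoughForm I M 3) (α : RoughForm I M 1)
    (V : ∀ x : M, TangentSpace I x) : Prop :=
  ContMDiff I I.tangent ∞ (fun x => (⟨x, V x⟩ : TangentBundle I M)) ∧
    ∀ (x : M) (u w : TangentSpace I x), α.extDeriv x ![u, w] = -σ x ![V x, u, w]

/-- A smooth `1`-form is Hamiltonian if it has a Hamiltonian vector field. -/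
def IsHamiltonianForm [IsManifold I 1 M] (σ : RoughForm I M 3) (α : RoughForm I M 1) : Prop :=
  α.IsSmooth ∧ ∃ V : ∀ x : M, TangentSpace I x, IsHamiltonianVectorField σ α V

theorem RoughForm.inChart_add {k : ℕ} (σ η : RoughForm I M k) (x₀ : M) :
    (σ + η).inChart x₀ = σ.inChart x₀ + η.inChart x₀ := rfl

theorem RoughForm.inChart_smul {k : ℕ} (c : ℝ) (σ : RoughForm I M k) (x₀ : M) :
    (c • σ).inChart x₀ = c • σ.inChart x₀ := rfl

theorem RoughForm.IsSmooth.add {k : ℕ} {σ η : RoughForm I M k} (hs : σ.IsSmooth)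
    (hη : η.IsSmooth) : (σ + η).IsSmooth :=
  fun x₀ => (hs x₀).add (hη x₀)

theorem RoughForm.IsSmooth.smul {k : ℕ} {σ : RoughForm I M k} (c : ℝ) (hs : σ.IsSmooth) :
    (c • σ).IsSmooth :=
  fun x₀ => (hs x₀).const_smul c

theorem RoughForm.IsSmooth.differentiableWithinAt {k : ℕ} {σ : RoughForm I M k}
    (hs : σ.IsSmooth) (x : M) :
    DifferentiableWithinAt ℝ (σ.inChart x) (range I) (extChartAt I x x) :=
  ((hs x).differentiableOn (by simp) _ (mem_extChartAt_target x)).mono_of_mem_nhdsWithin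
    (extChartAt_target_mem_nhdsWithin x)

theorem RoughForm.extDeriv_add {k : ℕ} {σ η : RoughForm I M k} (hs : σ.IsSmooth)
    (hη : η.IsSmooth) : (σ + η).extDeriv = σ.extDeriv + η.extDeriv := by
  funext x
  simp only [RoughForm.extDeriv, RoughForm.inChart_add]
  rw [extDerivWithin_add (I.uniqueDiffOn.uniqueDiffWithinAt (extChartAt_target_subset_range x
    (mem_extChartAt_target x))) (hs.differentiableWithinAt x)
    (hη.differentiableWithinAt x)]
  rfl

theorem RoughForm.extDeriv_smul {k : ℕ} (c : ℝ) (σ : RoughForm I M k) :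
    (c • σ).extDeriv = c • σ.extDeriv := by
  funext x
  simp only [RoughForm.extDeriv, RoughForm.inChart_smul]
  rw [extDerivWithin_smul c _ (I.uniqueDiffOn.uniqueDiffWithinAt
    (extChartAt_target_subset_range x (mem_extChartAt_target x)))]
  rfl

end Forms

/-! ### Lie groups -/

instance : ENat.LEInfty (minSmoothness ℝ 3) := ⟨by
  rw [minSmoothness_of_isRCLikeNormedField]; exact ENat.LEInfty.out⟩

section LieGroups

variable {E : Type*} [NormedAddCommGroup E] [NormedSpace ℝ E]
  {H : Type*} [TopologicalSpace H] (I : ModelWithCorners ℝ E H)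
  {G : Type*} [TopologicalSpace G] [ChartedSpace H G] [Group G]

/-- The adjoint representation: the derivative at `1` of `h ↦ g h g⁻¹`.
(This map fixes `1`, and its derivative is an endomorphism of the tangent space at `1`.) -/
noncomputable def lieAd (g : G) : GroupLieAlgebra I G →L[ℝ] GroupLieAlgebra I G :=
  mfderiv I I (fun h : G => g * h * g⁻¹) 1

/-- The left-invariant Maurer-Cartan form `θ_L` at `g`: the derivative at `g` of `h ↦ g⁻¹ h`, which
sends `g` to `1`. -/
noncomputable def maurerCartan (g : G) : TangentSpace I g →L[ℝ] GroupLieAlgebra I G :=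
  mfderiv I I (fun h : G => g⁻¹ * h) g

/-- An inner product on the Lie algebra that is invariant under the adjoint representation. -/
structure IsAdInvariantInnerProduct (B : LinearMap.BilinForm ℝ (GroupLieAlgebra I G)) : Prop where
  symm : ∀ x y, B x y = B y x
  pos : ∀ x, x ≠ 0 → 0 < B x x
  invariant : ∀ (g : G) x y, B (lieAd I g x) (lieAd I g y) = B x y

/-- `ν` is the Cartan 3-form `ν_k = k ⟨θ_L, [θ_L, θ_L]⟩`. -/
def IsCartanForm (B : LinearMap.BilinForm ℝ (GroupLieAlgebra I G)) (k : ℝ)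
    (ν : RoughForm I G 3) : Prop :=
  ∀ (g : G) (u v w : TangentSpace I g), ν g ![u, v, w] =
    k * B (maurerCartan I g u) ⁅maurerCartan I g v, maurerCartan I g w⁆

variable {I}

/-- A form is left-invariant if it is preserved by the pullback along every left translation. -/
def RoughForm.IsLeftInvariant {k : ℕ} (σ : RoughForm I G k) : Prop :=
  ∀ g x : G, (σ (g * x)).compContinuousLinearMap (mfderiv I I (fun h : G => g * h) x) = σ x

/-- The space `Ham(G, ν)^L` of left-invariant Hamiltonian `1`-forms. -/
def leftInvariantHamiltonianForms [IsManifold I 1 G] (ν : RoughForm I G 3) :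
    Submodule ℝ (RoughForm I G 1) where
  carrier := {α | IsHamiltonianForm ν α ∧ α.IsLeftInvariant}
  zero_mem' := by
    have h0 : (0 : RoughForm I G 1) = (0 : ℝ) • (0 : RoughForm I G 1) := by simp
    refine ⟨⟨fun x₀ => ?_, fun _ => 0, ?_, fun x u w => ?_⟩, fun g x => rfl⟩
    · exact contDiffOn_const (c := (0 : E [⋀^Fin 1]→L[ℝ] ℝ))
    · exact Bundle.contMDiff_zeroSection ℝ (TangentSpace I (M := G))
    · rw [h0, RoughForm.extDeriv_smul, zero_smul,
        (ν x).map_coord_zero (m := ![0, u, w]) 0 rfl]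
      simp
  add_mem' := by
    rintro α β ⟨⟨hα, V, hV, hV'⟩, hαL⟩ ⟨⟨hβ, W, hW, hW'⟩, hβL⟩
    refine ⟨⟨hα.add hβ, fun x => V x + W x, hV.add_section hW, fun x u w => ?_⟩, fun g x => ?_⟩
    · rw [RoughForm.extDeriv_add hα hβ]
      have h := (ν x).toMultilinearMap.cons_add ![u, w] (V x) (W x)
      have h' : ν x ![V x + W x, u, w] = ν x ![V x, u, w] + ν x ![W x, u, w] := h
      rw [h', neg_add, ← hV', ← hW']
      rfl
    · exact congrArg₂ (· + ·) (hαL g x) (hβL g x)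
  smul_mem' := by
    rintro c α ⟨⟨hα, V, hV, hV'⟩, hαL⟩
    refine ⟨⟨hα.smul c, fun x => c • V x, hV.const_smul_section, fun x u w => ?_⟩, fun g x => ?_⟩
    · rw [RoughForm.extDeriv_smul]
      have h := (ν x).toMultilinearMap.cons_smul ![u, w] c (V x)
      have h' : ν x ![c • V x, u, w] = c • ν x ![V x, u, w] := h
      rw [h', ← smul_neg, ← hV']
      rfl
    · exact congrArg (c • ·) (hαL g x)

variable (I G) in
/-- The space `C^∞(G)^L` of left-invariant smooth functions. -/
def leftInvariantFunctions : Submodule ℝ (G → ℝ) where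
  carrier := {f | ContMDiff I 𝓘(ℝ, ℝ) ∞ f ∧ ∀ g x : G, f (g * x) = f x}
  zero_mem' := ⟨contMDiff_const, fun _ _ => rfl⟩
  add_mem' := by
    rintro f h ⟨hf, hf'⟩ ⟨hh, hh'⟩
    exact ⟨hf.add hh, fun g x => by simp [hf', hh']⟩
  smul_mem' := by
    rintro c f ⟨hf, hf'⟩
    exact ⟨contMDiff_const.mul (f := fun _ => c) hf, fun g x => by simp [hf']⟩

/-- `L` is the Lie 2-algebra `Lie(G, ν)^L` of left-invariant Hamiltonian `1`-forms: the complex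
is `d : C^∞(G)^L → Ham(G, ν)^L`, the bracket is `{α, β} = ν(v_α, v_β, ·)` in degree 0 and trivial
otherwise, and the Jacobiator is `J(α, β, γ) = -ν(v_α, v_β, v_γ)`, with `v_α`, `v_β`, `v_γ` the
Hamiltonian vector fields. -/
structure IsHamiltonianLie2Algebra [IsManifold I 1 G] (ν : RoughForm I G 3)
    (L : Lie2Algebra (leftInvariantFunctions I G) (leftInvariantHamiltonianForms ν)) : Prop where
  d_eq : ∀ f : leftInvariantFunctions I G,
    (L.d f : RoughForm I G 1) = RoughForm.ofFunction (f : G → ℝ)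
  bracket_eq : ∀ (α β : leftInvariantHamiltonianForms ν) (V W : ∀ x : G, TangentSpace I x),
    IsHamiltonianVectorField ν α V → IsHamiltonianVectorField ν β W →
      ∀ (x : G) (u : TangentSpace I x),
        (L.bracket α β : RoughForm I G 1) x ![u] = ν x ![V x, W x, u]
  act_eq : ∀ (α : leftInvariantHamiltonianForms ν) (f : leftInvariantFunctions I G),
    L.act α f = 0
  J_eq : ∀ (α β γ : leftInvariantHamiltonianForms ν) (U V W : ∀ x : G, TangentSpace I x),
    IsHamiltonianVectorField ν α U → IsHamiltonianVectorField ν β V →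
      IsHamiltonianVectorField ν γ W →
        ∀ x : G, (L.J α β γ : G → ℝ) x = -ν x ![U x, V x, W x]

/-- `S` is the string Lie 2-algebra `𝔤_k`: the complex is `0 : ℝ → 𝔤`, the bracket is the Lie
bracket in degree 0 and trivial otherwise, and the Jacobiator is `k ⟨x, [y, z]⟩`. -/
structure IsStringLie2Algebra (B : LinearMap.BilinForm ℝ (GroupLieAlgebra I G)) (k : ℝ)
    (S : Lie2Algebra ℝ (GroupLieAlgebra I G)) : Prop where
  d_eq : ∀ c, S.d c = 0
  bracket_eq : ∀ x y, S.bracket x y = ⁅x, y⁆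
  act_eq : ∀ x c, S.act x c = 0
  J_eq : ∀ x y z, S.J x y z = k * B x ⁅y, z⁆

end LieGroups

/-! Left translations trivialise the tangent bundle, so a left-invariant form is the pullback along
`θ_L` of a form `T` on `𝔤`, and everything reduces to algebra on `𝔤`. On left-invariant fields such
a form is constant, so its exterior derivative keeps only bracket terms
(`extDeriv_leftInvariantForm`, the Chevalley-Eilenberg formula).

Differentiating `Ad`-invariance at the unit gives `⟨[z,x],y⟩ + ⟨x,[z,y]⟩ = 0`
(`lie_invariant_of_lieAd_invariant`), hence `k⟨x,[y,z]⟩` is alternating. The Jacobi identity, paired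
with an element, becomes a three-term relation between products `⟨[a,b],[c,d]⟩` (`bilin_lie_lie`).
It gives both `dν = 0` and the coherence law of `𝔤_k`. Nondegeneracy holds because a vector in the
kernel of `ν` is central, and a simple Lie algebra has no centre.

For `α_v = k⟨v, θ_L⟩` the degree-one formula reads `dα_v = -ν(v^L, ·, ·)`, where `v^L` is the
left-invariant field of `v`, so `v^L` is Hamiltonian for `α_v`. By positivity and finite dimension,
`v ↦ α_v` is a linear isomorphism from `𝔤` onto the left-invariant Hamiltonian forms. It carries
`[v,w]` to `{α_v, α_w}`; left-invariant functions are constants, identified with `ℝ` by `c ↦ -c` to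
match the Jacobiators. So `Lie(G,ν)^L` is `𝔤_k` transported along these isomorphisms. -/

/-! ### Alternating forms: smooth dependence of pullbacks, continuity -/

section Alternating

variable {E F : Type*} [NormedAddCommGroup E] [NormedSpace ℝ E]
  [NormedAddCommGroup F] [NormedSpace ℝ F]

/-- Antisymmetrization of continuous multilinear forms, normalized to be a left inverse of the
inclusion of alternating forms. -/
noncomputable def antisymmetrization (k : ℕ) :
    ContinuousMultilinearMap ℝ (fun _ : Fin k => E) ℝ →L[ℝ] E [⋀^Fin k]→L[ℝ] ℝ :=
  LinearMap.mkContinuous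
    { toFun := fun f => ((k.factorial : ℝ)⁻¹) • f.alternatization
      map_add' := fun f g => by rw [map_add, smul_add]
      map_smul' := fun c f => by
        ext v
        simp only [ContinuousAlternatingMap.smul_apply,
          ContinuousMultilinearMap.alternatization_apply_apply, Finset.smul_sum,
          smul_apply, RingHom.id_apply]
        refine Finset.sum_congr rfl fun σ _ => ?_
        rw [smul_comm c, smul_comm c (Equiv.Perm.sign σ)] }
    -- Each of the `k!` summands has norm at most `‖f‖ ∏ ‖v i‖`, and the normalisation cancels `k!`.
    1 fun f => by
      refine ContinuousAlternatingMap.opNorm_le_bound _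
        (by positivity) fun v => ?_
      have hk : (0 : ℝ) < k.factorial := by positivity
      have h1 : ∀ σ ∈ (Finset.univ : Finset (Equiv.Perm (Fin k))),
          ‖Equiv.Perm.sign σ • f (v ∘ σ)‖ ≤ ‖f‖ * ∏ i, ‖v i‖ := fun σ _ => by
        have h2 : ‖Equiv.Perm.sign σ • f (v ∘ σ)‖ = ‖f (v ∘ σ)‖ := by
          rcases Int.units_eq_one_or (Equiv.Perm.sign σ) with h | h <;> simp [h]
        rw [h2]
        refine (f.le_opNorm _).trans (le_of_eq ?_)
        congr 1
        exact Equiv.prod_comp σ fun i => ‖v i‖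
      have h3 := norm_sum_le_of_le _ h1
      simp only [LinearMap.coe_mk, AddHom.coe_mk, ContinuousAlternatingMap.smul_apply,
        ContinuousMultilinearMap.alternatization_apply_apply, norm_smul]
      rw [Finset.sum_const, Finset.card_univ, Fintype.card_perm, Fintype.card_fin,
        nsmul_eq_mul] at h3
      rw [norm_inv, Real.norm_of_nonneg hk.le, one_mul, inv_mul_le_iff₀ hk]
      exact h3

theorem antisymmetrization_coe {k : ℕ} (f : E [⋀^Fin k]→L[ℝ] ℝ) :
    antisymmetrization k f.toContinuousMultilinearMap = f := by
  ext v
  have hk : (k.factorial : ℝ) ≠ 0 := by positivity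
  change ((k.factorial : ℝ)⁻¹) • (f.toContinuousMultilinearMap.alternatization v) = f v
  have h : ∀ σ ∈ (Finset.univ : Finset (Equiv.Perm (Fin k))),
      Equiv.Perm.sign σ • f.toContinuousMultilinearMap (v ∘ σ) = f v := fun σ _ => by
    have h1 : f.toContinuousMultilinearMap (v ∘ σ) = Equiv.Perm.sign σ • f v :=
      f.toAlternatingMap.map_perm v σ
    rw [h1, smul_smul, Int.units_mul_self, one_smul]
  rw [ContinuousMultilinearMap.alternatization_apply_apply, Finset.sum_congr rfl h,
    Finset.sum_const, Finset.card_univ, Fintype.card_perm, Fintype.card_fin, nsmul_eq_mul,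
    smul_eq_mul, inv_mul_cancel_left₀ hk]

/-- The pullback of a fixed alternating form along a linear map depends smoothly on this map. -/
theorem contDiff_compContinuousLinearMap {k : ℕ} (T : F [⋀^Fin k]→L[ℝ] ℝ) {n : ℕ∞ω} :
    ContDiff ℝ n (fun A : E →L[ℝ] F => T.compContinuousLinearMap A) := by
  -- For multilinear maps the pullback is multilinear in the tuple of linear maps, here evaluated on
  -- the diagonal. The continuous linear retraction onto alternating forms transfers smoothness.
  have h : (fun A : E →L[ℝ] F => T.compContinuousLinearMap A) = fun A =>
      antisymmetrization k
        (T.toContinuousMultilinearMap.compContinuousLinearMapLRight fun _ => A) :=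
    funext fun A => (antisymmetrization_coe (T.compContinuousLinearMap A)).symm
  rw [h]
  refine ContDiff.comp (𝕜 := ℝ) (ContinuousLinearMap.contDiff (antisymmetrization (E := E) k)) ?_
  apply (ContinuousMultilinearMap.contDiff _).comp
  exact contDiff_pi.2 fun _ => contDiff_id

/-- An alternating map on a finite-dimensional space is continuous. -/
def AlternatingMap.toContinuousOfFiniteDimensional [FiniteDimensional ℝ E] {k : ℕ}
    (f : E [⋀^Fin k]→ₗ[ℝ] ℝ) : E [⋀^Fin k]→L[ℝ] ℝ :=
  { f with
    cont := by
      let b := Module.finBasis ℝ E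
      have h : ∀ v : Fin k → E, f v = ∑ r : Fin k → Fin (Module.finrank ℝ E),
          (∏ i, b.repr (v i) (r i)) • f (fun i => b (r i)) := fun v => by
        conv_lhs => rw [show v = fun i => ∑ j, b.repr (v i) j • b j from
          funext fun i => (b.sum_repr (v i)).symm]
        have h1 := f.toMultilinearMap.map_sum (fun i j => b.repr (v i) j • b j)
        refine h1.trans (Finset.sum_congr rfl fun r _ => ?_)
        exact f.toMultilinearMap.map_smul_univ (fun i => b.repr (v i) (r i)) fun i => b (r i)
      have h2 : ∀ j, Continuous fun w : E => b.repr w j := fun j =>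
        (b.coord j).continuous_of_finiteDimensional
      change Continuous fun v => f v
      rw [show (fun v => f v) = _ from funext h]
      exact continuous_finsetSum _ fun r _ => (continuous_finsetProd _ fun i _ =>
        (h2 (r i)).comp (continuous_apply i)).smul continuous_const }

end Alternating

/-! ### Invariant vector fields, the Maurer-Cartan form and left-invariant forms -/

section LieGroup

open VectorField Bundle Function

variable {E : Type*} [NormedAddCommGroup E] [NormedSpace ℝ E]
  {H : Type*} [TopologicalSpace H] {I : ModelWithCorners ℝ E H}
  {G : Type*} [TopologicalSpace G] [ChartedSpace H G] [Group G] [LieGroup I ∞ G]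

/-- Invariant vector fields on a smooth Lie group are smooth. -/
theorem contMDiff_infty_mulInvariantVectorField (v : GroupLieAlgebra I G) :
    ContMDiff I I.tangent ∞
      (fun g : G => (⟨g, mulInvariantVectorField v g⟩ : TangentBundle I G)) := by
  -- The field is the tangent map of multiplication applied to the smooth section `g ↦ (0_g, v)`
  -- over `(g, 1)`.
  have h1 : ContMDiff I (I.tangent.prod I.tangent) ∞ fun g : G =>
      ((⟨g, 0⟩, ⟨1, v⟩) : TangentBundle I G × TangentBundle I G) :=
    (contMDiff_zeroSection ℝ (TangentSpace I)).prodMk contMDiff_const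
  have h2 : ContMDiff (I.prod I).tangent I.tangent ∞
      (tangentMap (I.prod I) I fun p : G × G => p.1 * p.2) :=
    ContMDiff.contMDiff_tangentMap (contMDiff_mul I ∞) (m := ∞) le_rfl
  have h3 := (h2.comp contMDiff_equivTangentBundleProd_symm).comp h1
  have h4 : ∀ g y : G, y = g → ∀ w : E,
      (⟨y, w⟩ : TangentBundle I G) = ⟨g, w⟩ := by rintro g _ rfl w; rfl
  refine h3.congr fun g => ?_
  have h5 := mfderiv_prod_eq_add_apply (p := (g, (1 : G))) (v := (show TangentSpace (I.prod I) (g, (1 : G)) from ((0 : E), v)))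
    ((contMDiff_mul I ∞ (G := G)).mdifferentiableAt (by simp))
  have h6 : (mfderiv I I (fun x : G => x * 1) g : E →L[ℝ] E) 0 = 0 := map_zero _
  refine Eq.trans ?_ (h4 g (g * 1) (mul_one g) _).symm
  exact congrArg (TotalSpace.mk g) (h5.trans ((congrArg (· + _) h6).trans (zero_add _))).symm

theorem mdifferentiableAt_mul_left' (g x : G) :
    MDifferentiableAt I I (fun h : G => g * h) x :=
  (contMDiff_mul_left (I := I) (n := ∞)).mdifferentiableAt (by simp)

theorem mfderiv_mul_left_comp (a g x : G) :
    (mfderiv I I (fun h : G => a * h) (g * x)).comp (mfderiv I I (fun h : G => g * h) x) =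
      mfderiv I I (fun h : G => a * g * h) x := by
  rw [← mfderiv_comp (I' := I) x (mdifferentiableAt_mul_left' a _)
    (mdifferentiableAt_mul_left' g x)]
  congr 1
  ext h
  simp [mul_assoc]



-- Every tangent space is definitionally `E`, so derivatives at base points that are only
-- propositionally equal can be compared as endomorphisms of `E`.
omit [LieGroup I ∞ G] in
theorem mfderiv_mul_left_congr {a b x y : G} (hab : a = b) (hxy : x = y) :
    (mfderiv I I (fun h : G => a * h) x : E →L[ℝ] E) = mfderiv I I (fun h : G => b * h) y := by
  subst hab hxy
  rfl

omit [LieGroup I ∞ G] in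
theorem mfderiv_mul_left_eq_id {a : G} (ha : a = 1) (x : G) :
    (mfderiv I I (fun h : G => a * h) x : E →L[ℝ] E) = ContinuousLinearMap.id ℝ E := by
  have h : ∀ f : G → G, f = id →
      (mfderiv I I f x : E →L[ℝ] E) = ContinuousLinearMap.id ℝ E := by
    rintro f rfl
    exact mfderiv_id
  exact h _ (by ext; simp [ha])

/-- The chain rule for `g⁻¹ * (g * h) = h`. With its converse below it makes `θ_L` a pointwise
inverse of the left-invariant frame. -/
theorem maurerCartan_mulInvariantVectorField (v : GroupLieAlgebra I G) (g : G) :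
    maurerCartan I g (mulInvariantVectorField v g) = v := by
  have h := DFunLike.congr_fun (mfderiv_mul_left_comp (I := I) g⁻¹ g 1) v
  have h2 := DFunLike.congr_fun (mfderiv_mul_left_eq_id (I := I) (inv_mul_cancel g) 1) v
  have h3 := mfderiv_mul_left_congr (I := I) (rfl : g⁻¹ = g⁻¹) (mul_one g)
  exact (DFunLike.congr_fun h3 _).symm.trans (h.trans h2)

theorem mulInvariantVectorField_maurerCartan (g : G) (u : TangentSpace I g) :
    mulInvariantVectorField (maurerCartan I g u) g = u := by
  have h := DFunLike.congr_fun (mfderiv_mul_left_comp (I := I) g g⁻¹ g) u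
  have h2 := DFunLike.congr_fun (mfderiv_mul_left_eq_id (I := I) (mul_inv_cancel g) g) u
  have h3 := mfderiv_mul_left_congr (I := I) (rfl : g = g) (inv_mul_cancel g)
  exact (DFunLike.congr_fun h3 _).symm.trans (h.trans h2)

/-- Left invariance of `θ_L`, from `(g x)⁻¹ g = x⁻¹`. -/
theorem maurerCartan_mul_comp (g x : G) :
    (maurerCartan I (g * x)).comp (mfderiv I I (fun h : G => g * h) x) = maurerCartan I x :=
  (mfderiv_mul_left_comp (I := I) (g * x)⁻¹ g x).trans
    (mfderiv_mul_left_congr (by simp) rfl)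

/-- The left-invariant form with value `T` at the identity. -/
noncomputable def leftInvariantForm {k : ℕ} (T : GroupLieAlgebra I G [⋀^Fin k]→L[ℝ] ℝ) :
    RoughForm I G k :=
  fun g => T.compContinuousLinearMap (maurerCartan I g)

theorem leftInvariantForm_isLeftInvariant {k : ℕ} (T : GroupLieAlgebra I G [⋀^Fin k]→L[ℝ] ℝ) :
    (leftInvariantForm T).IsLeftInvariant := fun g x => by
  ext v
  have h := fun i => DFunLike.congr_fun (maurerCartan_mul_comp (I := I) g x) (v i)
  exact congrArg T (funext h)

-- Translation by `g⁻¹` brings the value at `g` back to `1`, and its derivative at `g` is `θ_L` by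
-- definition.
omit [LieGroup I ∞ G] in
theorem RoughForm.IsLeftInvariant.eq_leftInvariantForm {k : ℕ} {σ : RoughForm I G k}
    (hσ : σ.IsLeftInvariant) : σ = leftInvariantForm (σ 1) := by
  funext g
  rw [← hσ g⁻¹ g]
  have h : ∀ y : G, y = 1 → ∀ A : E →L[ℝ] E,
      (ContinuousAlternatingMap.compContinuousLinearMap (σ y : E [⋀^Fin k]→L[ℝ] ℝ) A :
        E [⋀^Fin k]→L[ℝ] ℝ) =
      ContinuousAlternatingMap.compContinuousLinearMap (σ 1 : E [⋀^Fin k]→L[ℝ] ℝ) A := by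
    rintro y rfl A; rfl
  exact h _ (inv_mul_cancel g) _

/-- The vector field `V` in the preferred chart at `x₀`. -/
noncomputable abbrev fieldInChart (x₀ : G) (V : ∀ x : G, TangentSpace I x) : E → E :=
  mpullbackWithin 𝓘(ℝ, E) I (extChartAt I x₀).symm V (range I)

/-- The inverse of the derivative of the inverse chart is the bundle trivialisation at `x₀`, so the
chart expression is the fibre coordinate of a smooth section. -/
theorem contDiffOn_fieldInChart {x₀ : G} {V : ∀ x : G, TangentSpace I x}
    (hV : ContMDiff I I.tangent ∞ (fun g : G => (⟨g, V g⟩ : TangentBundle I G))) :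
    ContDiffOn ℝ ∞ (fieldInChart x₀ V) (extChartAt I x₀).target := by
  have h1 := ((trivializationAt E (TangentSpace I) x₀).contMDiffOn_section_baseSet_iff
    (IB := I) (n := ∞)).1 hV.contMDiffOn
  have h2 := h1.comp (contMDiffOn_extChartAt_symm (I := I) (n := ∞) x₀) fun y hy => by
    simpa using (extChartAt I x₀).map_target hy
  rw [← contMDiffOn_iff_contDiffOn]
  refine h2.congr fun y hy => ?_
  have hs : (extChartAt I x₀).symm y ∈ (chartAt H x₀).source := by
    simpa using (extChartAt I x₀).map_target hy
  have h3 := TangentBundle.continuousLinearMapAt_trivializationAt (I := I) hs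
  have h4 := DFunLike.congr_fun h3 (V ((extChartAt I x₀).symm y))
  have h6 := Trivialization.continuousLinearMapAt_apply_of_mem (R := ℝ)
    (trivializationAt E (TangentSpace I) x₀)
    (b := (extChartAt I x₀).symm y) (by simpa using hs) (V ((extChartAt I x₀).symm y))
  have h5 := ContinuousLinearMap.inverse_eq
    (mfderivWithin_extChartAt_symm_comp_mfderiv_extChartAt hy)
    (mfderiv_extChartAt_comp_mfderivWithin_extChartAt_symm hy)
  exact (DFunLike.congr_fun h5 (V ((extChartAt I x₀).symm y))).trans (h4.symm.trans h6)

end LieGroup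

/-! ### Coordinate expressions and the exterior derivative of left-invariant forms -/

section LieGroup

open VectorField Bundle Function

variable {E : Type*} [NormedAddCommGroup E] [NormedSpace ℝ E]
  {H : Type*} [TopologicalSpace H] {I : ModelWithCorners ℝ E H}
  {G : Type*} [TopologicalSpace G] [ChartedSpace H G] [Group G] [LieGroup I ∞ G]

variable (I) in
/-- The Maurer-Cartan form in the preferred chart at `x₀`. -/
noncomputable def maurerCartanInChart (x₀ : G) (y : E) : E →L[ℝ] E :=
  (maurerCartan I ((extChartAt I x₀).symm y)).comp (chartSymmDeriv x₀ y)

variable (I) in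
/-- The left-invariant frame in the preferred chart at `x₀`. -/
noncomputable def frameInChart (x₀ : G) (y : E) : E →L[ℝ] E :=
  (mfderivWithin 𝓘(ℝ, E) I (extChartAt I x₀).symm (range I) y).inverse.comp
    (mfderiv I I (fun h : G => (extChartAt I x₀).symm y * h) 1 : E →L[ℝ] E)

theorem maurerCartanInChart_frameInChart {x₀ : G} {y : E} (hy : y ∈ (extChartAt I x₀).target)
    (v : GroupLieAlgebra I G) : maurerCartanInChart I x₀ y (frameInChart I x₀ y v) = v := by
  have h := (isInvertible_mfderivWithin_extChartAt_symm hy).self_comp_inverse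
  have h2 := DFunLike.congr_fun h (mulInvariantVectorField v ((extChartAt I x₀).symm y))
  exact (congrArg (maurerCartan I ((extChartAt I x₀).symm y)) h2).trans
    (maurerCartan_mulInvariantVectorField v _)

theorem frameInChart_maurerCartanInChart {x₀ : G} {y : E} (hy : y ∈ (extChartAt I x₀).target)
    (u : E) : frameInChart I x₀ y (maurerCartanInChart I x₀ y u) = u := by
  have h := (isInvertible_mfderivWithin_extChartAt_symm hy).inverse_comp_self
  have h3 := mulInvariantVectorField_maurerCartan _ (chartSymmDeriv (I := I) x₀ y u)
  exact (congrArg (mfderivWithin 𝓘(ℝ, E) I (extChartAt I x₀).symm (range I) y).inverse h3).trans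
    (DFunLike.congr_fun h u)

variable [FiniteDimensional ℝ E] [CompleteSpace E]

omit [CompleteSpace E] in
theorem contDiffOn_frameInChart (x₀ : G) :
    ContDiffOn ℝ ∞ (fun y => frameInChart I x₀ y)
      (extChartAt I x₀).target :=
  contDiffOn_clm_apply.2 fun v =>
    contDiffOn_fieldInChart (contMDiff_infty_mulInvariantVectorField v)

/-- In the chart `θ_L` is the inverse of the smooth invertible operator given by the frame, and
operator inversion is smooth at invertible points. -/
theorem contDiffOn_maurerCartanInChart (x₀ : G) :
    ContDiffOn ℝ ∞ (fun y => maurerCartanInChart I x₀ y)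
      (extChartAt I x₀).target := by
  have h : ∀ y ∈ (extChartAt I x₀).target,
      ∃ e : E ≃L[ℝ] E, (e : E →L[ℝ] E) = frameInChart I x₀ y ∧
        (e.symm : E →L[ℝ] E) = maurerCartanInChart I x₀ y := fun y hy =>
    ⟨.equivOfInverse (frameInChart I x₀ y) (maurerCartanInChart I x₀ y)
      (maurerCartanInChart_frameInChart hy) (frameInChart_maurerCartanInChart hy), rfl, rfl⟩
  intro y hy
  obtain ⟨e, he, he'⟩ := h y hy
  have h1 : ContDiffAt ℝ ∞ ContinuousLinearMap.inverse (frameInChart I x₀ y) :=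
    he ▸ ContinuousLinearMap.IsInvertible.contDiffAt_map_inverse ⟨e, rfl⟩
  refine (h1.comp_contDiffWithinAt y (contDiffOn_frameInChart x₀ y hy)).congr_of_mem
    (fun z hz => ?_) hy
  obtain ⟨e', h2, h2'⟩ := h z hz
  rw [← h2', comp_apply, ← h2, ContinuousLinearMap.inverse_equiv]

theorem leftInvariantForm_isSmooth {k : ℕ} (T : GroupLieAlgebra I G [⋀^Fin k]→L[ℝ] ℝ) :
    (leftInvariantForm T).IsSmooth := fun x₀ =>
  (contDiff_compContinuousLinearMap (E := E) (F := E) T).comp_contDiffOn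
    (contDiffOn_maurerCartanInChart x₀)

-- `T_x G` is identified with `E` through the preferred chart at `x`, so at the centre of that chart
-- no change of basis appears.
omit [Group G] [LieGroup I ∞ G] [FiniteDimensional ℝ E] [CompleteSpace E] in
theorem fieldInChart_self [IsManifold I 1 G] (x : G) (V : ∀ x : G, TangentSpace I x) :
    fieldInChart x V (extChartAt I x x) = V x := by
  have h : ∀ y : G, y = x → (V y : E) = V x := by rintro y rfl; rfl
  have h2 := mfderivWithin_extChartAt_symm_inverse_apply (I := I) (V x)
  exact (congrArg (mfderivWithin 𝓘(ℝ, E) I (extChartAt I x).symm (range I)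
    (extChartAt I x x)).inverse (h _ (extChartAt_to_inv x))).trans h2

omit [Group G] [LieGroup I ∞ G] [FiniteDimensional ℝ E] [CompleteSpace E] in
theorem lieBracketWithin_fieldInChart [IsManifold I 1 G] (x : G)
    (V W : ∀ x : G, TangentSpace I x) :
    lieBracketWithin ℝ (fieldInChart x V) (fieldInChart x W) (range I) (extChartAt I x x) =
      mlieBracket I V W x := by
  have h : (mfderiv I 𝓘(ℝ, E) (extChartAt I x) x : E →L[ℝ] E).inverse =
      ContinuousLinearMap.id ℝ E :=
    (congrArg (ContinuousLinearMap.inverse (R := ℝ) (M := E) (M₂ := E))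
      (mfderiv_extChartAt_self (I := I) (x := x))).trans ContinuousLinearMap.inverse_id
  rw [mlieBracket, mlieBracketWithin_apply, preimage_univ, univ_inter]
  exact (DFunLike.congr_fun h _).symm

omit [FiniteDimensional ℝ E] in
theorem mlieBracket_mulInvariantVectorField (x : G) (v w : GroupLieAlgebra I G) :
    mlieBracket I (mulInvariantVectorField v) (mulInvariantVectorField w) x =
      mulInvariantVectorField ⁅v, w⁆ x :=
  (congrFun (mulInvariantVector_mlieBracket (I := I) v w) x).symm

/-- Extend the vectors `u l` to left-invariant fields and use the invariant formula for `d`. The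
form is constant on these fields, so the directional derivatives vanish and only brackets remain. -/
theorem extDeriv_leftInvariantForm {k : ℕ} (T : GroupLieAlgebra I G [⋀^Fin (k + 1)]→L[ℝ] ℝ)
    (x : G) (u : Fin (k + 2) → TangentSpace I x) :
    (leftInvariantForm T).extDeriv x u =
      -∑ i : Fin (k + 1), ∑ j ≥ i, (-1) ^ (i + j : ℕ) •
        T (Matrix.vecCons ⁅maurerCartan I x (u i.castSucc), maurerCartan I x (u j.succ)⁆
          (j.removeNth <| i.castSucc.removeNth fun l => maurerCartan I x (u l))) := by
  have hx := mem_extChartAt_target (I := I) x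
  have hω := (leftInvariantForm_isSmooth T).differentiableWithinAt x
  have hn := extChartAt_target_mem_nhdsWithin (I := I) x
  have hself := fun V => fieldInChart_self (I := I) x V
  have hbr := fun V W => lieBracketWithin_fieldInChart (I := I) x V W
  have hc : ∀ w : E, chartDeriv (I := I) x w = w :=
    fun w => DFunLike.congr_fun (mfderiv_extChartAt_self (I := I) (x := x)) w
  change extDerivWithin ((leftInvariantForm T).inChart x) (range I) (extChartAt I x x)
    (fun l => chartDeriv x (u l)) = _
  rw [show (fun l => chartDeriv x (u l)) = u from funext fun l => hc (u l)]
  generalize extChartAt I x x = y at *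
  let v : Fin (k + 2) → GroupLieAlgebra I G := fun l => maurerCartan I x (u l)
  let V : Fin (k + 2) → E → E := fun l => fieldInChart x (mulInvariantVectorField (v l))
  have hV : ∀ i, DifferentiableWithinAt ℝ (V i) (range I) y := fun i =>
    ((contDiffOn_fieldInChart (contMDiff_infty_mulInvariantVectorField (v i))).differentiableOn
      (by simp) y hx).mono_of_mem_nhdsWithin hn
  have hT : ∀ z ∈ (extChartAt I x).target, ∀ w : Fin (k + 1) → GroupLieAlgebra I G,
      (leftInvariantForm T).inChart x z (fun l => frameInChart I x z (w l)) = T w :=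
    fun z hz w => congrArg T (funext fun l => maurerCartanInChart_frameInChart hz (w l))
  have hu : (V · y) = u := funext fun l =>
    (hself _).trans (mulInvariantVectorField_maurerCartan x (u l))
  have key := extDerivWithin_apply_vectorField hω hV
    (I.uniqueDiffOn.uniqueDiffWithinAt (extChartAt_target_subset_range x hx))
  have hd : ∀ i : Fin (k + 2), fderivWithin ℝ (fun z => (leftInvariantForm T).inChart x z
      (i.removeNth (V · z))) (range I) y = 0 := fun i => by
    have h : (fun z => (leftInvariantForm T).inChart x z (i.removeNth (V · z)))
        =ᶠ[𝓝[range I] y] fun _ => T (i.removeNth v) :=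
      Filter.eventuallyEq_of_mem hn fun z hz =>
        hT z hz (i.removeNth v)
    rw [h.fderivWithin_eq (hT y hx (i.removeNth v)), fderivWithin_fun_const]
    rfl
  -- The bracket of left-invariant fields is again left-invariant, so it is the frame applied to the
  -- bracket in `𝔤`.
  have hb : ∀ i j, lieBracketWithin ℝ (V i) (V j) (range I) y = frameInChart I x y
      (⁅v i, v j⁆ : GroupLieAlgebra I G) :=
    fun i j => (hbr _ _).trans
      ((mlieBracket_mulInvariantVectorField x (v i) (v j)).trans
        (hself (mulInvariantVectorField ⁅v i, v j⁆)).symm)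
  have hs : ∀ (i : Fin (k + 1)) (j : Fin (k + 1)),
      (leftInvariantForm T).inChart x y (Matrix.vecCons
        (lieBracketWithin ℝ (V i.castSucc) (V j.succ) (range I) y)
          (j.removeNth <| i.castSucc.removeNth u)) =
        T (Matrix.vecCons ⁅v i.castSucc, v j.succ⁆
          (j.removeNth <| i.castSucc.removeNth v)) := fun i j => by
    rw [hb, ← hT y hx, ← hu]
    congr 1
    funext l
    refine Fin.cases ?_ (fun l => ?_) l <;> rfl
  rw [hu] at key
  rw [key]
  refine (congrArg₂ (· - ·) (Finset.sum_eq_zero fun i _ => ?_) (Finset.sum_congr rfl fun i _ =>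
    Finset.sum_congr rfl fun j _ => congrArg _ (hs i j))).trans (zero_sub _)
  rw [hd i]
  simp

end LieGroup

/-! ### Second-order calculus of a product and its conjugation -/

section Calculus

variable {E F : Type*} [NormedAddCommGroup E] [NormedSpace ℝ E]
  [NormedAddCommGroup F] [NormedSpace ℝ F]

theorem fderiv_prod_right {f : E × E → F} {p : E × E} (hf : DifferentiableAt ℝ f p) (x : E) :
    fderiv ℝ (fun t => f (p.1, t)) p.2 x = fderiv ℝ f p (0, x) := by
  have h : HasFDerivAt (fun t : E => (p.1, t)) ((0 : E →L[ℝ] E).prod (.id ℝ E)) p.2 :=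
    (hasFDerivAt_const _ _).prodMk (hasFDerivAt_id _)
  have h2 : HasFDerivAt (fun t => f (p.1, t)) _ p.2 :=
    HasFDerivAt.comp (g := f) p.2 hf.hasFDerivAt h
  rw [h2.fderiv]
  simp

theorem fderiv_prod_left {f : E × E → F} {p : E × E} (hf : DifferentiableAt ℝ f p) (x : E) :
    fderiv ℝ (fun t => f (t, p.2)) p.1 x = fderiv ℝ f p (x, 0) := by
  have h : HasFDerivAt (fun t : E => (t, p.2)) ((ContinuousLinearMap.id ℝ E).prod 0) p.1 :=
    (hasFDerivAt_id _).prodMk (hasFDerivAt_const _ _)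
  have h2 : HasFDerivAt (fun t => f (t, p.2)) _ p.1 :=
    HasFDerivAt.comp (g := f) p.1 hf.hasFDerivAt h
  rw [h2.fderiv]
  simp

theorem hasFDerivAt_fderiv_prod {f : E × E → F} {i : E → E × E} {i' : E →L[ℝ] E × E} {b : E}
    (hf : ContDiffAt ℝ ∞ f (i b)) (hi : HasFDerivAt i i' b) :
    HasFDerivAt (fun a => fderiv ℝ f (i a)) ((fderiv ℝ (fderiv ℝ f) (i b)).comp i') b := by
  have h1 : ContDiffAt ℝ 1 (fderiv ℝ f) (i b) := hf.fderiv_right (by norm_cast)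
  exact (h1.differentiableAt (by simp)).hasFDerivAt.comp b hi

/-- For a product `m` with unit `b` and its conjugation `c`, the derivative of the adjoint action
is the commutator of the second derivative of `m`. -/
theorem hasFDerivAt_fderiv_conj {m c : E × E → E} {b : E} (hm : ContDiffAt ℝ ∞ m (b, b))
    (hc : ContDiffAt ℝ ∞ c (b, b)) (hmc : ∀ᶠ p in 𝓝 (b, b), m (c p, p.1) = m p)
    (hcb : ∀ a, c (a, b) = b) (hr : ∀ x, fderiv ℝ m (b, b) (0, x) = x)
    (hl : ∀ x, fderiv ℝ m (b, b) (x, 0) = x) (x : E) :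
    fderiv ℝ c (b, b) (0, x) = x ∧ ∃ D : E →L[ℝ] E,
      HasFDerivAt (fun a => fderiv ℝ c (a, b) (0, x)) D b ∧
      ∀ z, D z = fderiv ℝ (fderiv ℝ m) (b, b) (z, 0) (0, x)
        - fderiv ℝ (fderiv ℝ m) (b, b) (x, 0) (0, z) := by
  have hi : HasFDerivAt (fun a : E => (a, b)) ((ContinuousLinearMap.id ℝ E).prod 0) b :=
    (hasFDerivAt_id _).prodMk (hasFDerivAt_const _ _)
  have hj : HasFDerivAt (fun a : E => (b, a)) ((0 : E →L[ℝ] E).prod (.id ℝ E)) b :=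
    (hasFDerivAt_const _ _).prodMk (hasFDerivAt_id _)
  have hmd : ∀ᶠ p in 𝓝 (b, b), DifferentiableAt ℝ m p :=
    ((hm.of_le (m := 1) (by simp)).eventually (by simp)).mono
      fun p hp => hp.differentiableAt (by simp)
  have hcd : ∀ᶠ p in 𝓝 (b, b), DifferentiableAt ℝ c p :=
    ((hc.of_le (m := 1) (by simp)).eventually (by simp)).mono
      fun p hp => hp.differentiableAt (by simp)
  -- Differentiate `m (c (a, t), a) = m (a, t)` in `t` at `b`, using `c (a, b) = b`. Inversion never
  -- has to be differentiated.
  have e1 : ∀ᶠ a in 𝓝 b, fderiv ℝ m (b, a) (fderiv ℝ c (a, b) (0, x), 0) =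
      fderiv ℝ m (a, b) (0, x) := by
    filter_upwards [hi.continuousAt.eventually hmc.eventually_nhds, hj.continuousAt.eventually hmd,
      hi.continuousAt.eventually hcd] with a h1 h2 h3
    have h4 : HasFDerivAt (fun p : E × E => (c p, p.1))
        ((fderiv ℝ c (a, b)).prod (.fst ℝ E E)) (a, b) := h3.hasFDerivAt.prodMk hasFDerivAt_fst
    have h5 : HasFDerivAt (fun p : E × E => m (c p, p.1)) _ (a, b) :=
      HasFDerivAt.comp (g := m) (a, b) (g' := fderiv ℝ m (b, a))
        (by simpa only [hcb] using h2.hasFDerivAt) h4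
    have h6 : (fun p : E × E => m (c p, p.1)) =ᶠ[𝓝 (a, b)] m := h1
    rw [← h6.fderiv_eq, h5.fderiv]
    simp
  have e2 : fderiv ℝ c (b, b) (0, x) = x := by
    have h := e1.self_of_nhds
    rwa [hl, hr] at h
  have hC := (hasFDerivAt_fderiv_prod (i := fun a => (a, b)) hc hi).clm_apply
    (hasFDerivAt_const ((0 : E), x) b)
  refine ⟨e2, _, hC, fun z => ?_⟩
  -- Now differentiate `e1` in `a` at `b`: the left side gives `D²m (0, z) (x, 0) + D z`, the right
  -- side `D²m (z, 0) (0, x)`. Symmetry of `D²m` then swaps `(0, z)` and `(x, 0)`.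
  have hR := (hasFDerivAt_fderiv_prod (i := fun a => (b, a)) hm hj).clm_apply
    (hC.prodMk (hasFDerivAt_const (0 : E) b))
  have hA := (hasFDerivAt_fderiv_prod (i := fun a => (a, b)) hm hi).clm_apply
    (hasFDerivAt_const ((0 : E), x) b)
  have h := DFunLike.congr_fun ((hR.congr_of_eventuallyEq
    (Filter.EventuallyEq.symm e1)).unique hA) z
  have hs := (hm.isSymmSndFDerivAt (by simpa using ENat.LEInfty.out)).eq (0, z) (x, 0)
  simp [e2, hl] at h ⊢
  rw [← h, hs]
  abel

end Calculus

/-! ### From `Ad`-invariance to `ad`-invariance -/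

section LieGroup

open VectorField Bundle Function

variable {E : Type*} [NormedAddCommGroup E] [NormedSpace ℝ E]
  {H : Type*} [TopologicalSpace H] (I : ModelWithCorners ℝ E H)
  (G : Type*) [TopologicalSpace G] [ChartedSpace H G] [Group G]

/-- The multiplication in the preferred chart at `1`. -/
noncomputable def mulInChart (p : E × E) : E :=
  extChartAt I (1 : G) ((extChartAt I (1 : G)).symm p.1 * (extChartAt I (1 : G)).symm p.2)

/-- The conjugation `(g, h) ↦ g h g⁻¹` in the preferred chart at `1`. -/
noncomputable def conjInChart (p : E × E) : E :=
  extChartAt I (1 : G) ((extChartAt I (1 : G)).symm p.1 * (extChartAt I (1 : G)).symm p.2 *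
    ((extChartAt I (1 : G)).symm p.1)⁻¹)

variable {I G}

theorem mfderiv_comp_extChartAt_symm [IsManifold I 1 G] [I.Boundaryless] {f : G → G} {x : G}
    (hf : MDifferentiableAt I I f 1)
    (h1 : f 1 ∈ (extChartAt I x).source) (v : E) :
    fderiv ℝ (fun t => extChartAt I x (f ((extChartAt I (1 : G)).symm t))) (extChartAt I (1 : G) 1)
      v = mfderiv I 𝓘(ℝ, E) (extChartAt I x) (f 1) (mfderiv I I f 1 v) := by
  have h2 : MDifferentiableAt I 𝓘(ℝ, E) (extChartAt I x) (f 1) :=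
    mdifferentiableAt_extChartAt (by simpa using h1)
  have h3 := mfderiv_comp (1 : G) h2 hf
  refine Eq.trans ?_ (DFunLike.congr_fun h3 v)
  have h4 := (h2.comp _ hf).mfderiv
  rw [I.range_eq_univ, fderivWithin_univ] at h4
  exact (DFunLike.congr_fun h4 v).symm

theorem lieAd_eq_fderiv [LieGroup I ∞ G] [I.Boundaryless] (g : G) (v : E) :
    lieAd I g v = fderiv ℝ (fun t => extChartAt I (1 : G) (g * (extChartAt I (1 : G)).symm t * g⁻¹))
      (extChartAt I (1 : G) 1) v := by
  have h : MDifferentiableAt I I (fun h : G => g * h * g⁻¹) 1 :=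
    ((contMDiff_mul_right (I := I) (n := ∞) (a := g⁻¹)).comp
      (contMDiff_mul_left (I := I) (n := ∞) (a := g))).mdifferentiableAt (by simp)
  have h2 : ∀ y : G, y = 1 → fderiv ℝ (fun t => extChartAt I y
      (g * (extChartAt I (1 : G)).symm t * g⁻¹)) (extChartAt I (1 : G) 1) v =
      fderiv ℝ (fun t => extChartAt I (1 : G) (g * (extChartAt I (1 : G)).symm t * g⁻¹))
      (extChartAt I (1 : G) 1) v := by rintro y rfl; rfl
  have h3 := h.mfderiv
  rw [I.range_eq_univ, fderivWithin_univ] at h3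
  exact (DFunLike.congr_fun h3 v).trans (h2 (g * 1 * g⁻¹) (by simp))

variable [LieGroup I ∞ G] [I.Boundaryless]

theorem contMDiffAt_extChartAt_one_symm :
    ContMDiffAt 𝓘(ℝ, E) I ∞ (extChartAt I (1 : G)).symm (extChartAt I (1 : G) 1) :=
  (contMDiffOn_extChartAt_symm 1).contMDiffAt (extChartAt_target_mem_nhds 1)

theorem contMDiffAt_extChartAt_one_symm_fst :
    ContMDiffAt 𝓘(ℝ, E × E) I ∞ (fun p : E × E => (extChartAt I (1 : G)).symm p.1)
      (extChartAt I (1 : G) 1, extChartAt I (1 : G) 1) :=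
  ContMDiffAt.comp (I' := 𝓘(ℝ, E)) (g := (extChartAt I (1 : G)).symm) (f := Prod.fst)
    (extChartAt I (1 : G) 1, extChartAt I (1 : G) 1) contMDiffAt_extChartAt_one_symm
    contDiffAt_fst.contMDiffAt

theorem contMDiffAt_extChartAt_one_symm_snd :
    ContMDiffAt 𝓘(ℝ, E × E) I ∞ (fun p : E × E => (extChartAt I (1 : G)).symm p.2)
      (extChartAt I (1 : G) 1, extChartAt I (1 : G) 1) :=
  ContMDiffAt.comp (I' := 𝓘(ℝ, E)) (g := (extChartAt I (1 : G)).symm) (f := Prod.snd)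
    (extChartAt I (1 : G) 1, extChartAt I (1 : G) 1) contMDiffAt_extChartAt_one_symm
    contDiffAt_snd.contMDiffAt

theorem contDiffAt_mulInChart :
    ContDiffAt ℝ ∞ (mulInChart I G) (extChartAt I (1 : G) 1, extChartAt I (1 : G) 1) :=
  (ContMDiffAt.comp (g := extChartAt I (1 : G)) _ (contMDiffAt_extChartAt' (by simp))
    (contMDiffAt_extChartAt_one_symm_fst.mul contMDiffAt_extChartAt_one_symm_snd)).contDiffAt

theorem contDiffAt_conjInChart :
    ContDiffAt ℝ ∞ (conjInChart I G) (extChartAt I (1 : G) 1, extChartAt I (1 : G) 1) :=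
  (ContMDiffAt.comp (g := extChartAt I (1 : G)) _ (contMDiffAt_extChartAt' (by simp))
    ((contMDiffAt_extChartAt_one_symm_fst.mul contMDiffAt_extChartAt_one_symm_snd).mul
      contMDiffAt_extChartAt_one_symm_fst.inv)).contDiffAt

/-- This is `(g h g⁻¹) g = g h`; near the unit `g h g⁻¹` stays in the chart domain, so passing
through the chart loses nothing. -/
theorem eventually_mulInChart_conjInChart :
    ∀ᶠ p in 𝓝 (extChartAt I (1 : G) 1, extChartAt I (1 : G) 1),
      mulInChart I G (conjInChart I G p, p.1) = mulInChart I G p := by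
  have h3 := ((contMDiffAt_extChartAt_one_symm_fst.mul contMDiffAt_extChartAt_one_symm_snd).mul
    (contMDiffAt_extChartAt_one_symm_fst (I := I) (G := G)).inv).continuousAt.preimage_mem_nhds
      (t := (extChartAt I (1 : G)).source)
    (by simpa using extChartAt_source_mem_nhds (I := I) (1 : G))
  filter_upwards [h3] with p hp
  simp only [mulInChart, conjInChart]
  have hp' := (extChartAt I (1 : G)).left_inv hp
  simp only [Pi.mul_apply] at hp'
  rw [hp', inv_mul_cancel_right]

omit [LieGroup I ∞ G] [I.Boundaryless] in
theorem conjInChart_one (a : E) :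
    conjInChart I G (a, extChartAt I (1 : G) 1) = extChartAt I (1 : G) 1 := by
  simp [conjInChart]

theorem eventually_differentiableAt_mulInChart :
    ∀ᶠ p in 𝓝 (extChartAt I (1 : G) 1, extChartAt I (1 : G) 1),
      DifferentiableAt ℝ (mulInChart I G) p :=
  ((contDiffAt_mulInChart.of_le (m := 1) (by simp)).eventually (by simp)).mono
    fun p hp => hp.differentiableAt (by simp)

theorem fderiv_mulInChart_right (x : E) :
    fderiv ℝ (mulInChart I G) (extChartAt I (1 : G) 1, extChartAt I (1 : G) 1) (0, x) = x := by
  rw [← fderiv_prod_right eventually_differentiableAt_mulInChart.self_of_nhds]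
  have h : (fun t => mulInChart I G (extChartAt I (1 : G) 1, t)) =ᶠ[𝓝 (extChartAt I (1 : G) 1)]
      id := by
    filter_upwards [extChartAt_target_mem_nhds (I := I) (1 : G)] with t ht
    simpa [mulInChart] using (extChartAt I (1 : G)).right_inv ht
  rw [h.fderiv_eq, fderiv_id]
  rfl

theorem fderiv_mulInChart_left (x : E) :
    fderiv ℝ (mulInChart I G) (extChartAt I (1 : G) 1, extChartAt I (1 : G) 1) (x, 0) = x := by
  rw [← fderiv_prod_left eventually_differentiableAt_mulInChart.self_of_nhds]
  have h : (fun t => mulInChart I G (t, extChartAt I (1 : G) 1)) =ᶠ[𝓝 (extChartAt I (1 : G) 1)]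
      id := by
    filter_upwards [extChartAt_target_mem_nhds (I := I) (1 : G)] with t ht
    simpa [mulInChart] using (extChartAt I (1 : G)).right_inv ht
  rw [h.fderiv_eq, fderiv_id]
  rfl

/-- Writing the frame as a partial derivative of the product makes the bracket computable from
second derivatives of the product. -/
theorem eventually_fieldInChart_one (v : E) :
    ∀ᶠ a in 𝓝 (extChartAt I (1 : G) 1), frameInChart I (1 : G) a v =
      fderiv ℝ (mulInChart I G) (a, extChartAt I (1 : G) 1) (0, v) := by
  have hc : ContinuousAt (fun a : E => (a, extChartAt I (1 : G) 1)) (extChartAt I (1 : G) 1) := by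
    fun_prop
  filter_upwards [hc.eventually eventually_differentiableAt_mulInChart,
    extChartAt_target_mem_nhds (I := I) (1 : G)] with a h1 ha
  have h5 := ContinuousLinearMap.inverse_eq
    (mfderivWithin_extChartAt_symm_comp_mfderiv_extChartAt ha)
    (mfderiv_extChartAt_comp_mfderivWithin_extChartAt_symm ha)
  have h2 := mfderiv_comp_extChartAt_symm (I := I) (x := 1)
    (mdifferentiableAt_mul_left' ((extChartAt I (1 : G)).symm a) 1)
    (by simpa using (extChartAt I (1 : G)).map_target ha) v
  rw [← fderiv_prod_right h1]
  refine (DFunLike.congr_fun h5 _).trans (Eq.trans ?_ h2.symm)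
  have h3 : ∀ g h : G, g = h → ∀ u : E, (mfderiv I 𝓘(ℝ, E) (extChartAt I (1 : G)) g : E →L[ℝ] E) u =
    (mfderiv I 𝓘(ℝ, E) (extChartAt I (1 : G)) h : E →L[ℝ] E) u := by rintro g _ rfl u; rfl
  exact h3 _ _ (mul_one _).symm _

/-- At the unit the frame is the identity, so the bracket of two invariant fields is the commutator
of their derivatives. This is the expression in `hasFDerivAt_fderiv_conj`, whence the derivative of
`Ad` is the bracket. -/
theorem bracket_eq_fderiv_mulInChart [CompleteSpace E] (z x : E) :
    @Bracket.bracket (GroupLieAlgebra I G) (GroupLieAlgebra I G) _ z x =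
      fderiv ℝ (fderiv ℝ (mulInChart I G)) (extChartAt I (1 : G) 1, extChartAt I (1 : G) 1)
        (z, 0) (0, x) -
      fderiv ℝ (fderiv ℝ (mulInChart I G)) (extChartAt I (1 : G) 1, extChartAt I (1 : G) 1)
        (x, 0) (0, z) := by
  have hi : HasFDerivAt (fun a : E => (a, extChartAt I (1 : G) 1))
      ((ContinuousLinearMap.id ℝ E).prod 0) (extChartAt I (1 : G) 1) :=
    (hasFDerivAt_id _).prodMk (hasFDerivAt_const _ _)
  have h := lieBracketWithin_fieldInChart (I := I) (1 : G) (mulInvariantVectorField z)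
    (mulInvariantVectorField x)
  rw [I.range_eq_univ, lieBracketWithin_univ] at h
  refine h.symm.trans ?_
  change lieBracket ℝ (fun a => frameInChart I (1 : G) a z) (fun a => frameInChart I (1 : G) a x)
    _ = _
  have hf : ∀ w : E, HasFDerivAt (fun a => frameInChart I (1 : G) a w) _ (extChartAt I (1 : G) 1) := fun w =>
    ((hasFDerivAt_fderiv_prod (i := fun a => (a, extChartAt I (1 : G) 1))
      contDiffAt_mulInChart hi).clm_apply
        (hasFDerivAt_const ((0 : E), w) _)).congr_of_eventuallyEq
      (eventually_fieldInChart_one w)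
  have hv : ∀ w : E, frameInChart I (1 : G) (extChartAt I (1 : G) 1) w = w := fun w =>
    (eventually_fieldInChart_one w).self_of_nhds.trans (fderiv_mulInChart_right w)
  rw [lieBracket, (hf x).fderiv, (hf z).fderiv, hv, hv]
  simp

/-- An `Ad`-invariant bilinear form is invariant under the adjoint action of the Lie algebra. -/
theorem lie_invariant_of_lieAd_invariant [FiniteDimensional ℝ E] [CompleteSpace E]
    (B : LinearMap.BilinForm ℝ (GroupLieAlgebra I G))
    (hB : ∀ (g : G) x y, B (lieAd I g x) (lieAd I g y) = B x y) (z x y : GroupLieAlgebra I G) :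
    B ⁅z, x⁆ y + B x ⁅z, y⁆ = 0 := by
  let B' : E →ₗ[ℝ] E →ₗ[ℝ] ℝ := B
  let Bc : E →L[ℝ] E →L[ℝ] ℝ := B'.toContinuousBilinearMap
  let br : E → E → E := fun z x =>
    @Bracket.bracket (GroupLieAlgebra I G) (GroupLieAlgebra I G) _ z x
  suffices ∀ z x y : E, B' (br z x) y + B' x (br z y) = 0 from this z x y
  clear z x y
  intro z x y
  have key := fun w : E => hasFDerivAt_fderiv_conj (contDiffAt_mulInChart (I := I) (G := G))
    contDiffAt_conjInChart eventually_mulInChart_conjInChart conjInChart_one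
    fderiv_mulInChart_right fderiv_mulInChart_left w
  obtain ⟨hx, Dx, hDx, hDx'⟩ := key x
  obtain ⟨hy, Dy, hDy, hDy'⟩ := key y
  have hd : ∀ᶠ p in 𝓝 (extChartAt I (1 : G) 1, extChartAt I (1 : G) 1),
      DifferentiableAt ℝ (conjInChart I G) p :=
    ((contDiffAt_conjInChart.of_le (m := 1) (by simp)).eventually (by simp)).mono
      fun p hp => hp.differentiableAt (by simp)
  have hi : ContinuousAt (fun a : E => (a, extChartAt I (1 : G) 1)) (extChartAt I (1 : G) 1) := by
    fun_prop
  have hAd : ∀ᶠ a in 𝓝 (extChartAt I (1 : G) 1), ∀ w : E,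
      fderiv ℝ (conjInChart I G) (a, extChartAt I (1 : G) 1) (0, w) =
        lieAd I ((extChartAt I (1 : G)).symm a) w := by
    filter_upwards [hi.eventually hd] with a ha w
    rw [← fderiv_prod_right ha]
    exact (lieAd_eq_fderiv (I := I) ((extChartAt I (1 : G)).symm a) w).symm
  -- Near the unit `a ↦ ⟨Ad_a x, Ad_a y⟩` is constant; its derivative at the unit, where `Ad` is the
  -- identity, is the claimed sum and must vanish.
  have h1 : (fun a => Bc (fderiv ℝ (conjInChart I G) (a, extChartAt I (1 : G) 1) (0, x))
      (fderiv ℝ (conjInChart I G) (a, extChartAt I (1 : G) 1) (0, y)))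
      =ᶠ[𝓝 (extChartAt I (1 : G) 1)] fun _ => B' x y := by
    filter_upwards [hAd] with a ha
    rw [ha, ha]
    exact hB _ x y
  have h2 := Bc.hasFDerivAt_of_bilinear hDx hDy
  have h3 := DFunLike.congr_fun
    (h2.unique ((hasFDerivAt_const (B' x y) _).congr_of_eventuallyEq h1)) z
  have hzx : Dx z = br z x :=
    (hDx' z).trans (bracket_eq_fderiv_mulInChart (G := G) z x).symm
  have hzy : Dy z = br z y :=
    (hDy' z).trans (bracket_eq_fderiv_mulInChart (G := G) z y).symm
  rw [hx, hy] at h3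
  have h4 : Bc x (Dy z) + Bc (Dx z) y = 0 := h3
  rw [hzx, hzy, add_comm] at h4
  exact h4

end LieGroup

/-! ### Transport of Lie 2-algebras -/

namespace Lie2Algebra

variable {L₁ L₀ M₁ M₀ : Type*}
  [AddCommGroup L₁] [Module ℝ L₁] [AddCommGroup L₀] [Module ℝ L₀]
  [AddCommGroup M₁] [Module ℝ M₁] [AddCommGroup M₀] [Module ℝ M₀]

/-- Transport of a Lie 2-algebra structure along linear equivalences. -/
def transport (L : Lie2Algebra L₁ L₀) (e₁ : L₁ ≃ₗ[ℝ] M₁) (e₀ : L₀ ≃ₗ[ℝ] M₀) :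
    Lie2Algebra M₁ M₀ where
  d := e₀ ∘ₗ L.d ∘ₗ e₁.symm
  bracket := (L.bracket.compl₁₂ (e₀.symm : M₀ →ₗ[ℝ] L₀) (e₀.symm : M₀ →ₗ[ℝ] L₀)).compr₂ e₀
  act := (L.act.compl₁₂ (e₀.symm : M₀ →ₗ[ℝ] L₀) (e₁.symm : M₁ →ₗ[ℝ] L₁)).compr₂ e₁
  J :=
    { toFun := fun x => ((L.J (e₀.symm x)).compl₁₂ (e₀.symm : M₀ →ₗ[ℝ] L₀)
        (e₀.symm : M₀ →ₗ[ℝ] L₀)).compr₂ e₁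
      map_add' := fun x y => by ext; simp
      map_smul' := fun c x => by ext; simp }
  bracket_skew x y := by simp [L.bracket_skew (e₀.symm x)]
  d_act x a := by simp [L.d_act]
  act_d a b := by simp [L.act_d (e₁.symm a)]
  J_swap_left x y z := by simp [L.J_swap_left (e₀.symm x)]
  J_swap_right x y z := by simp [L.J_swap_right (e₀.symm x) (e₀.symm y)]
  d_J x y z := by simp [L.d_J]
  J_d x y a := by simp [L.J_d]
  coherence x y z w := by
    simpa using congrArg e₁ (L.coherence (e₀.symm x) (e₀.symm y) (e₀.symm z) (e₀.symm w))

/-- The two equivalences preserve all structure strictly, so the homotopy `0` works in both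
directions. -/
theorem isomorphic_transport (L : Lie2Algebra L₁ L₀) (e₁ : L₁ ≃ₗ[ℝ] M₁) (e₀ : L₀ ≃ₗ[ℝ] M₀) :
    L.Isomorphic (L.transport e₁ e₀) := by
  refine ⟨⟨e₀, e₁, 0, ?_, ?_, ?_, ?_, ?_⟩, ⟨e₀.symm, e₁.symm, 0, ?_, ?_, ?_, ?_, ?_⟩, ?_, ?_⟩
  all_goals first
    | (intros; simp [transport]; done)
    | (apply Hom.ext <;> ext <;> simp [Hom.comp, Hom.id])

end Lie2Algebra

/-! ### Algebra of an `ad`-invariant symmetric form; the string Lie 2-algebra -/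

section StringLie2Algebra

variable {g : Type*} [LieRing g] [LieAlgebra ℝ g] (B : LinearMap.BilinForm ℝ g) (k : ℝ)

/-- The trilinear form `k ⟨x, [y, z]⟩`. -/
def cartanTrilinear : g →ₗ[ℝ] g →ₗ[ℝ] g →ₗ[ℝ] ℝ where
  toFun x := ((LieModule.toEnd ℝ g g : g →ₗ[ℝ] Module.End ℝ g)).compr₂ (k • B x)
  map_add' x y := by ext; simp
  map_smul' c x := by ext; simp; ring

@[simp]
theorem cartanTrilinear_apply (x y z : g) : cartanTrilinear B k x y z = k * B x ⁅y, z⁆ := rfl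

variable {B}

section

variable (hs : ∀ x y, B x y = B y x) (hB : ∀ z x y : g, B ⁅z, x⁆ y + B x ⁅z, y⁆ = 0)
include hs hB

theorem bilin_lie_swap_left (x y z : g) : B x ⁅y, z⁆ = -B y ⁅x, z⁆ := by
  have h := hB z x y
  rw [hs ⁅z, x⁆ y, ← lie_skew z y, ← lie_skew z x, map_neg, map_neg] at h
  linarith

omit hs hB in
theorem bilin_lie_swap_right (x y z : g) : B x ⁅y, z⁆ = -B x ⁅z, y⁆ := by
  rw [← lie_skew y z, map_neg]

omit hs in
theorem bilin_lie_left (x y z : g) : B ⁅x, y⁆ z = B x ⁅y, z⁆ := by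
  have h := hB y x z
  rw [← lie_skew y x, map_neg, LinearMap.neg_apply] at h
  linarith

omit hs in
/-- The `4`-form obtained by differentiating the Cartan form vanishes. -/
theorem bilin_lie_lie (a b c d : g) :
    B ⁅a, b⁆ ⁅c, d⁆ - B ⁅a, c⁆ ⁅b, d⁆ + B ⁅a, d⁆ ⁅b, c⁆ = 0 := by
  -- Moving `b`, `c`, `d` across leaves `⟨a, [b,[c,d]] - [c,[b,d]] + [d,[b,c]]⟩`, zero by Jacobi.
  rw [bilin_lie_left hB, bilin_lie_left hB, bilin_lie_left hB, ← map_sub, ← map_add,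
    leibniz_lie b c d, add_sub_cancel_right, ← lie_skew d, add_neg_cancel, map_zero]

omit hs in
/-- The trilinear form `k ⟨x, [y, z]⟩` as an alternating map. -/
def cartanAlternatingMap : g [⋀^Fin 3]→ₗ[ℝ] ℝ :=
  { MultilinearMap.mk' (M₁ := fun _ : Fin 3 => g) (fun m => cartanTrilinear B k (m 0) (m 1) (m 2))
      (fun m i x y => by
        obtain rfl | rfl | rfl : i = 0 ∨ i = 1 ∨ i = 2 := by lia
        all_goals simp [Function.update, mul_add])
      (fun m i c x => by
        obtain rfl | rfl | rfl : i = 0 ∨ i = 1 ∨ i = 2 := by lia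
        all_goals simp [Function.update]) with
    map_eq_zero_of_eq' := fun m i j h hij => by
      have h1 : ∀ a b : g, B a ⁅a, b⁆ = 0 := fun a b => by
        simpa using hB a a b
      have h2 : ∀ a b : g, B a ⁅b, a⁆ = 0 := fun a b => by
        rw [bilin_lie_swap_right, h1, neg_zero]
      obtain rfl | rfl | rfl : i = 0 ∨ i = 1 ∨ i = 2 := by lia
      all_goals obtain rfl | rfl | rfl : j = 0 ∨ j = 1 ∨ j = 2 := by lia
      all_goals first | exact absurd rfl hij | simp [h, h1, h2] }

/-- The string Lie 2-algebra. -/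
def stringLie2Algebra : Lie2Algebra ℝ g where
  d := 0
  bracket := (LieModule.toEnd ℝ g g : g →ₗ[ℝ] Module.End ℝ g)
  act := 0
  J := cartanTrilinear B k
  bracket_skew x y := (lie_skew x y).symm
  d_act x a := by simp
  act_d a b := by simp
  J_swap_left x y z := by
    simp only [cartanTrilinear_apply]
    rw [bilin_lie_swap_left hs hB, mul_neg]
  J_swap_right x y z := by
    simp only [cartanTrilinear_apply]
    rw [bilin_lie_swap_right, mul_neg]
  d_J x y z := by simp
  J_d x y a := by simp
  coherence x y z w := by
    -- The action is zero, and each of the six Jacobiator terms is `± k` times a product of two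
    -- brackets. Each product in the three-term relation occurs twice, hence the factor `-2 k`.
    have h := bilin_lie_lie hB x y z w
    have hl := fun a b c => bilin_lie_left (B := B) hB a b c
    have hr := fun a b => bilin_lie_swap_right (B := B) a b
    simp only [cartanTrilinear_apply, LinearMap.zero_apply, LieHom.coe_toLinearMap,
      LieModule.toEnd_apply_apply]
    rw [hr x ⁅y, z⁆, hr y ⁅x, z⁆, ← hl x w, ← hl x z, ← hl x y, ← hl y w, ← hl y z,
      hs ⁅y, w⁆, hs ⁅y, z⁆]
    linear_combination -2 * k * h

end

end StringLie2Algebra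

/-! ### The Cartan form: nondegeneracy, closedness, Hamiltonian fields -/

section LieGroup

open VectorField Bundle Function

variable {E : Type*} [NormedAddCommGroup E] [NormedSpace ℝ E]
  {H : Type*} [TopologicalSpace H] {I : ModelWithCorners ℝ E H}
  {G : Type*} [TopologicalSpace G] [ChartedSpace H G] [Group G] [LieGroup I ∞ G]

omit [LieGroup I ∞ G] in
/-- The differential of a left-invariant function vanishes. -/
theorem RoughForm.ofFunction_eq_zero (f : leftInvariantFunctions I G) :
    RoughForm.ofFunction (I := I) (f : G → ℝ) = 0 := by
  have h : (f : G → ℝ) = fun _ => (f : G → ℝ) 1 := funext fun x => by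
    simpa using f.2.2 x 1
  rw [h]
  funext x
  ext v
  rw [RoughForm.ofFunction, mfderiv_const]
  rfl

variable (I G) in
/-- Left-invariant functions are constant. The sign is chosen for compatibility with the
Jacobiators. -/
noncomputable def leftInvariantFunctionsEquiv : ℝ ≃ₗ[ℝ] leftInvariantFunctions I G where
  toFun c := ⟨fun _ => -c, contMDiff_const, fun _ _ => rfl⟩
  invFun f := -(f : G → ℝ) 1
  map_add' a b := Subtype.ext (funext fun _ => neg_add a b)
  map_smul' a b := Subtype.ext (funext fun _ => (mul_neg a b).symm)
  left_inv c := neg_neg c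
  right_inv f := Subtype.ext (funext fun x => by simpa using (f.2.2 x 1).symm)

variable [FiniteDimensional ℝ E] [CompleteSpace E]

/-- The value at `1` of the Cartan `3`-form. -/
noncomputable def cartanAlternating (B : LinearMap.BilinForm ℝ (GroupLieAlgebra I G))
    (hB : ∀ z x y : GroupLieAlgebra I G, B ⁅z, x⁆ y + B x ⁅z, y⁆ = 0) (k : ℝ) :
    GroupLieAlgebra I G [⋀^Fin 3]→L[ℝ] ℝ :=
  AlternatingMap.toContinuousOfFiniteDimensional (E := E) (cartanAlternatingMap k hB)

/-- The Cartan `3`-form. -/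
noncomputable def cartanForm (B : LinearMap.BilinForm ℝ (GroupLieAlgebra I G))
    (hB : ∀ z x y : GroupLieAlgebra I G, B ⁅z, x⁆ y + B x ⁅z, y⁆ = 0) (k : ℝ) :
    RoughForm I G 3 :=
  leftInvariantForm (cartanAlternating B hB k)

variable {B : LinearMap.BilinForm ℝ (GroupLieAlgebra I G)}
  (hs : ∀ x y, B x y = B y x) (hp : ∀ x, x ≠ 0 → 0 < B x x)
  (hB : ∀ z x y : GroupLieAlgebra I G, B ⁅z, x⁆ y + B x ⁅z, y⁆ = 0) {k : ℝ} (hk : k ≠ 0)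

theorem cartanForm_isCartanForm : IsCartanForm I B k (cartanForm B hB k) :=
  fun _ _ _ _ => rfl

-- With `ξ = θ_L v`, the hypothesis says `⟨ξ,[a,b]⟩ = 0`. Taking `b = [ξ,a]` and using invariance
-- gives `⟨[ξ,a],[ξ,a]⟩ = 0`, so `ξ` is central and therefore `0`.
include hp hk in
theorem cartanForm_nondegenerate [LieAlgebra.IsSimple ℝ (GroupLieAlgebra I G)] (x : G)
    (v : TangentSpace I x) (h : ∀ u w, cartanForm B hB k x ![v, u, w] = 0) : v = 0 := by
  have h1 : ∀ a b : GroupLieAlgebra I G, B (maurerCartan I x v) ⁅a, b⁆ = 0 := fun a b => by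
    have h2 := h (mulInvariantVectorField a x) (mulInvariantVectorField b x)
    rw [cartanForm_isCartanForm hB, maurerCartan_mulInvariantVectorField,
      maurerCartan_mulInvariantVectorField] at h2
    exact (mul_eq_zero.1 h2).resolve_left hk
  have h3 : ∀ a : GroupLieAlgebra I G, ⁅maurerCartan I x v, a⁆ = 0 := fun a => by
    by_contra h4
    have h5 := hp _ h4
    rw [bilin_lie_left hB, h1] at h5
    exact h5.false
  have h6 : maurerCartan I x v ∈ LieAlgebra.center ℝ (GroupLieAlgebra I G) := fun a => by
    rw [← lie_skew, h3, neg_zero]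
  rw [LieAlgebra.center_eq_bot] at h6
  have h7 : maurerCartan I x v = 0 := h6
  rw [← mulInvariantVectorField_maurerCartan x v, h7, mulInvariantVectorField]
  exact map_zero _

-- The six bracket terms in `d` of a 3-form pair off by symmetry of `⟨·,·⟩` into twice the relation
-- `bilin_lie_lie`.
include hs in
theorem cartanForm_closed : (cartanForm B hB k).extDeriv = 0 := by
  have key : ∀ f : Fin 4 → GroupLieAlgebra I G, ∑ i : Fin 3, ∑ j ≥ i, (-1) ^ (i + j : ℕ) •
      cartanAlternating B hB k (Matrix.vecCons ⁅f i.castSucc, f j.succ⁆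
        (j.removeNth <| i.castSucc.removeNth f)) = 0 := fun f => by
    have hT : ∀ m, cartanAlternating B hB k m = k * B (m 0) ⁅m 1, m 2⁆ := fun _ => rfl
    rw [Fin.sum_univ_three, show Finset.Ici (0 : Fin 3) = {0, 1, 2} from rfl,
      show Finset.Ici (1 : Fin 3) = {1, 2} from rfl, show Finset.Ici (2 : Fin 3) = {2} from rfl]
    have h := bilin_lie_lie hB (f 0) (f 1) (f 2) (f 3)
    simp [hT]
    change k * B ⁅f 0, f 1⁆ ⁅f 2, f 3⁆ + (-(k * B ⁅f 0, f 2⁆ ⁅f 1, f 3⁆) +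
      k * B ⁅f 0, f 3⁆ ⁅f 1, f 2⁆) + (k * B ⁅f 1, f 2⁆ ⁅f 0, f 3⁆ +
      (-1) ^ 3 * (k * B ⁅f 1, f 3⁆ ⁅f 0, f 2⁆)) + (-1) ^ 4 * (k * B ⁅f 2, f 3⁆ ⁅f 0, f 1⁆) = 0
    rw [hs ⁅f 1, f 2⁆, hs ⁅f 1, f 3⁆, hs ⁅f 2, f 3⁆]
    linear_combination 2 * k * h
  funext x
  ext u
  have h := extDeriv_leftInvariantForm (cartanAlternating B hB k) x u
  rw [key fun l => maurerCartan I x (u l), neg_zero] at h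
  exact h

/-- In degree one the formula for `d` has a single term, `-T [θ u, θ w] = -k⟨v, [θ u, θ w]⟩`. -/
theorem mulInvariantVectorField_isHamiltonian (v : GroupLieAlgebra I G)
    (T : GroupLieAlgebra I G [⋀^Fin 1]→L[ℝ] ℝ) (hT : ∀ w, T ![w] = k * B v w) :
    IsHamiltonianVectorField (cartanForm B hB k) (leftInvariantForm T)
      (mulInvariantVectorField v) := by
  refine ⟨contMDiff_infty_mulInvariantVectorField v, fun x u w => ?_⟩
  have h := extDeriv_leftInvariantForm T x ![u, w]
  rw [cartanForm_isCartanForm hB, maurerCartan_mulInvariantVectorField]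
  rw [Fin.sum_univ_one, show Finset.Ici (0 : Fin 1) = {0} from rfl, Finset.sum_singleton] at h
  refine h.trans (congrArg Neg.neg ?_)
  rw [← hT, Fin.val_zero, add_zero, pow_zero, one_smul]
  congr 1
  ext i
  fin_cases i
  rfl

/-- The `1`-form `k ⟨v, θ⟩` at the identity. -/
noncomputable def covector (B : LinearMap.BilinForm ℝ (GroupLieAlgebra I G)) (k : ℝ)
    (v : GroupLieAlgebra I G) : GroupLieAlgebra I G [⋀^Fin 1]→L[ℝ] ℝ :=
  ContinuousAlternatingMap.ofSubsingleton ℝ (GroupLieAlgebra I G) ℝ (0 : Fin 1)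
    (show E →L[ℝ] ℝ from LinearMap.toContinuousLinearMap (E := E) (k • B v))

omit [LieGroup I ∞ G] [CompleteSpace E] in
theorem covector_apply (v w : GroupLieAlgebra I G) : covector B k v ![w] = k * B v w := rfl

theorem continuousAlternatingMap_one_ext {V : Type*} [AddCommGroup V] [Module ℝ V]
    [TopologicalSpace V] {S T : V [⋀^Fin 1]→L[ℝ] ℝ} (h : ∀ w, S ![w] = T ![w]) : S = T := by
  ext m
  have hm : m = ![m 0] := by ext i; fin_cases i; rfl
  rw [hm]
  exact h _

-- Positivity makes `v ↦ ⟨v, ·⟩` injective into the dual, and equality of dimensions makes it onto;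
-- `v` represents `k⁻¹ T`.
omit [LieGroup I ∞ G] [CompleteSpace E] in
include hp hk in
theorem exists_covector_eq (T : GroupLieAlgebra I G [⋀^Fin 1]→L[ℝ] ℝ) :
    ∃ v, covector B k v = T := by
  have : FiniteDimensional ℝ (GroupLieAlgebra I G) := inferInstanceAs (FiniteDimensional ℝ E)
  have hi : Function.Injective B := by
    rw [← LinearMap.ker_eq_bot, LinearMap.ker_eq_bot']
    intro x hx
    by_contra h
    have h2 := hp x h
    rw [hx] at h2
    exact h2.false
  have hsurj := (LinearMap.injective_iff_surjective_of_finrank_eq_finrank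
    (f := B) (Subspace.dual_finrank_eq).symm).1 hi
  obtain ⟨v, hv⟩ := hsurj
    { toFun := fun w => k⁻¹ * T ![w]
      map_add' := fun a b => by
        rw [show T ![a + b] = T ![a] + T ![b] from T.toMultilinearMap.cons_add ![] a b, mul_add]
      map_smul' := fun c a => by
        rw [show T ![c • a] = c • T ![a] from T.toMultilinearMap.cons_smul ![] c a,
          mul_smul_comm, RingHom.id_apply] }
  refine ⟨v, continuousAlternatingMap_one_ext fun w => ?_⟩
  rw [covector_apply, hv]
  simp [hk]

end LieGroup

/-! ### Uniqueness, and the Lie 2-algebra of Hamiltonian forms -/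

section LieGroup

variable {E : Type*} [NormedAddCommGroup E] [NormedSpace ℝ E]
  {H : Type*} [TopologicalSpace H] {I : ModelWithCorners ℝ E H}
  {G : Type*} [TopologicalSpace G] [ChartedSpace H G] [Group G]

omit [Group G] in
theorem IsHamiltonianVectorField.unique [IsManifold I 1 G] {ν : RoughForm I G 3}
    (hν : ∀ (x : G) (v : TangentSpace I x), (∀ u w, ν x ![v, u, w] = 0) → v = 0)
    {α : RoughForm I G 1} {V W : ∀ x : G, TangentSpace I x}
    (hV : IsHamiltonianVectorField ν α V) (hW : IsHamiltonianVectorField ν α W) : V = W := by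
  funext x
  refine sub_eq_zero.1 (hν x _ fun u w => ?_)
  have h : ν x ![W x + (V x - W x), u, w] = ν x ![W x, u, w] + ν x ![V x - W x, u, w] :=
    (ν x).toMultilinearMap.cons_add ![u, w] (W x) (V x - W x)
  rw [add_sub_cancel] at h
  have h1 := hV.2 x u w
  have h2 := hW.2 x u w
  linarith

/-- All four structure maps are prescribed, since each form in the complex has some Hamiltonian
field to insert in the formulas. -/
theorem IsHamiltonianLie2Algebra.unique [IsManifold I 1 G] {ν : RoughForm I G 3}
    {L M : Lie2Algebra (leftInvariantFunctions I G) (leftInvariantHamiltonianForms ν)}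
    (hL : IsHamiltonianLie2Algebra ν L) (hM : IsHamiltonianLie2Algebra ν M) : L = M := by
  have hH := fun α : leftInvariantHamiltonianForms ν => α.2.1.2
  apply Lie2Algebra.ext
  · exact LinearMap.ext fun f => Subtype.ext ((hL.d_eq f).trans (hM.d_eq f).symm)
  · refine LinearMap.ext fun α => LinearMap.ext fun β => Subtype.ext (funext fun x => ?_)
    obtain ⟨V, hV⟩ := hH α
    obtain ⟨W, hW⟩ := hH β
    exact continuousAlternatingMap_one_ext fun u =>
      (hL.bracket_eq α β V W hV hW x u).trans (hM.bracket_eq α β V W hV hW x u).symm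
  · exact LinearMap.ext fun α => LinearMap.ext fun f => (hL.act_eq α f).trans (hM.act_eq α f).symm
  · refine LinearMap.ext fun α => LinearMap.ext fun β => LinearMap.ext fun γ =>
      Subtype.ext (funext fun x => ?_)
    obtain ⟨U, hU⟩ := hH α
    obtain ⟨V, hV'⟩ := hH β
    obtain ⟨W, hW⟩ := hH γ
    exact (hL.J_eq α β γ U V W hU hV' hW x).trans (hM.J_eq α β γ U V W hU hV' hW x).symm

variable [LieGroup I ∞ G] [CompleteSpace E] {B : LinearMap.BilinForm ℝ (GroupLieAlgebra I G)}
  (hs : ∀ x y, B x y = B y x) (hp : ∀ x, x ≠ 0 → 0 < B x x)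
  (hB : ∀ z x y : GroupLieAlgebra I G, B ⁅z, x⁆ y + B x ⁅z, y⁆ = 0) {k : ℝ} (hk : k ≠ 0)

omit [LieGroup I ∞ G] [CompleteSpace E] in
theorem IsStringLie2Algebra.unique {S T : Lie2Algebra ℝ (GroupLieAlgebra I G)}
    (hS : IsStringLie2Algebra B k S) (hT : IsStringLie2Algebra B k T) : S = T := by
  apply Lie2Algebra.ext
  · exact LinearMap.ext fun c => (hS.d_eq c).trans (hT.d_eq c).symm
  · exact LinearMap.ext fun x => LinearMap.ext fun y =>
      (hS.bracket_eq x y).trans (hT.bracket_eq x y).symm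
  · exact LinearMap.ext fun x => LinearMap.ext fun c => (hS.act_eq x c).trans (hT.act_eq x c).symm
  · exact LinearMap.ext fun x => LinearMap.ext fun y => LinearMap.ext fun z =>
      (hS.J_eq x y z).trans (hT.J_eq x y z).symm

theorem stringLie2Algebra_isStringLie2Algebra :
    IsStringLie2Algebra B k (stringLie2Algebra k hs hB) :=
  ⟨fun _ => rfl, fun _ _ => rfl, fun _ _ => rfl, fun _ _ _ => rfl⟩

variable [FiniteDimensional ℝ E]

/-- The linear isomorphism `v ↦ k ⟨v, θ⟩` from the Lie algebra to the left-invariant Hamiltonian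
`1`-forms. -/
noncomputable def hamiltonianFormsEquiv :
    GroupLieAlgebra I G ≃ₗ[ℝ] leftInvariantHamiltonianForms (cartanForm B hB k) :=
  LinearEquiv.ofBijective
    { toFun := fun v => ⟨leftInvariantForm (covector B k v),
        ⟨leftInvariantForm_isSmooth _, mulInvariantVectorField v,
          mulInvariantVectorField_isHamiltonian hB v _ fun w => covector_apply v w⟩,
        leftInvariantForm_isLeftInvariant _⟩
      map_add' := fun a b => Subtype.ext <| funext fun x =>
        continuousAlternatingMap_one_ext fun w => by
          change k * B (a + b) (maurerCartan I x w) =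
            k * B a (maurerCartan I x w) + k * B b (maurerCartan I x w)
          rw [map_add, LinearMap.add_apply, mul_add]
      map_smul' := fun c a => Subtype.ext <| funext fun x =>
        continuousAlternatingMap_one_ext fun w => by
          change k * B (c • a) (maurerCartan I x w) = c * (k * B a (maurerCartan I x w))
          rw [map_smul, LinearMap.smul_apply, smul_eq_mul, mul_left_comm] }
    ⟨fun v w h => by
      by_contra hvw
      -- Evaluating both forms at `1` on `v - w` yields `⟨v - w, v - w⟩ = 0`.
      have h1 : k * B v (maurerCartan I 1 (mulInvariantVectorField (v - w) 1)) =
          k * B w (maurerCartan I 1 (mulInvariantVectorField (v - w) 1)) :=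
        DFunLike.congr_fun (congrFun (congrArg Subtype.val h) 1)
          ![mulInvariantVectorField (v - w) 1]
      rw [maurerCartan_mulInvariantVectorField] at h1
      have h2 := hp (v - w) (sub_ne_zero.2 hvw)
      rw [map_sub B v w, LinearMap.sub_apply, mul_left_cancel₀ hk h1, sub_self] at h2
      exact h2.false, fun α => by
      obtain ⟨v, hv⟩ := exists_covector_eq hp hk (α.1 1)
      refine ⟨v, Subtype.ext ?_⟩
      change leftInvariantForm (covector B k v) = α.1
      rw [hv]
      exact α.2.2.eq_leftInvariantForm.symm⟩

theorem hamiltonianFormsEquiv_isHamiltonian (v : GroupLieAlgebra I G) :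
    IsHamiltonianVectorField (cartanForm B hB k)
      (hamiltonianFormsEquiv hp hB hk v : RoughForm I G 1) (mulInvariantVectorField v) :=
  mulInvariantVectorField_isHamiltonian hB v _ fun w => covector_apply v w

/-- Nondegeneracy leaves only one Hamiltonian field, so formulas quantified over all choices reduce
to identities in `𝔤`. -/
theorem eq_mulInvariantVectorField_symm [LieAlgebra.IsSimple ℝ (GroupLieAlgebra I G)]
    (α : leftInvariantHamiltonianForms (cartanForm B hB k)) (V : ∀ x : G, TangentSpace I x)
    (hV : IsHamiltonianVectorField (cartanForm B hB k) (α : RoughForm I G 1) V) :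
    V = mulInvariantVectorField ((hamiltonianFormsEquiv hp hB hk).symm α) := by
  have h := hamiltonianFormsEquiv_isHamiltonian hp hB hk
    ((hamiltonianFormsEquiv hp hB hk).symm α)
  rw [LinearEquiv.apply_symm_apply] at h
  exact hV.unique (cartanForm_nondegenerate hp hB hk) h

/-- The Lie 2-algebra of left-invariant Hamiltonian `1`-forms. -/
theorem transport_isHamiltonianLie2Algebra [LieAlgebra.IsSimple ℝ (GroupLieAlgebra I G)] :
    IsHamiltonianLie2Algebra (cartanForm B hB k)
      ((stringLie2Algebra k hs hB).transport (leftInvariantFunctionsEquiv I G)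
        (hamiltonianFormsEquiv hp hB hk)) where
  d_eq f := by
    rw [RoughForm.ofFunction_eq_zero]
    exact congrArg Subtype.val (map_zero (hamiltonianFormsEquiv hp hB hk))
  bracket_eq α β V W hV hW x u := by
    -- For `α = α_v`, `β = α_w` the right side is `k⟨v,[w,θ u]⟩ = k⟨[v,w],θ u⟩`, the value of
    -- `α_[v,w]`.
    rw [eq_mulInvariantVectorField_symm hp hB hk α V hV,
      eq_mulInvariantVectorField_symm hp hB hk β W hW, cartanForm_isCartanForm hB,
      maurerCartan_mulInvariantVectorField, maurerCartan_mulInvariantVectorField,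
      ← bilin_lie_left hB]
    rfl
  act_eq α f := map_zero (leftInvariantFunctionsEquiv I G)
  J_eq α β γ U V W hU hV hW x := by
    rw [eq_mulInvariantVectorField_symm hp hB hk α U hU,
      eq_mulInvariantVectorField_symm hp hB hk β V hV,
      eq_mulInvariantVectorField_symm hp hB hk γ W hW, cartanForm_isCartanForm hB,
      maurerCartan_mulInvariantVectorField, maurerCartan_mulInvariantVectorField,
      maurerCartan_mulInvariantVectorField]
    rfl

end LieGroup

theorem mainTheorem5 {n : ℕ} {G : Type*} [TopologicalSpace G]
    [ChartedSpace (EuclideanSpace ℝ (Fin n)) G] [Group G] [LieGroup (𝓡 n) ∞ G]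
    [T2Space G] [CompactSpace G] [LieAlgebra.IsSimple ℝ (GroupLieAlgebra (𝓡 n) G)]
    (B : LinearMap.BilinForm ℝ (GroupLieAlgebra (𝓡 n) G))
    (hB : IsAdInvariantInnerProduct (𝓡 n) B) (k : ℝ) (hk : k ≠ 0) :
    ∃ ν : RoughForm (𝓡 n) G 3,
      IsCartanForm (𝓡 n) B k ν ∧
      IsTwoPlectic ν ∧
      (∀ α : RoughForm (𝓡 n) G 1, α.IsSmooth → α.IsLeftInvariant → IsHamiltonianForm ν α) ∧
      (∃! S : Lie2Algebra ℝ (GroupLieAlgebra (𝓡 n) G), IsStringLie2Algebra B k S) ∧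
      (∃! L : Lie2Algebra (leftInvariantFunctions (𝓡 n) G) (leftInvariantHamiltonianForms ν),
        IsHamiltonianLie2Algebra ν L) ∧
      ∀ (S : Lie2Algebra ℝ (GroupLieAlgebra (𝓡 n) G))
        (L : Lie2Algebra (leftInvariantFunctions (𝓡 n) G) (leftInvariantHamiltonianForms ν)),
        IsStringLie2Algebra B k S → IsHamiltonianLie2Algebra ν L →
          Lie2Algebra.Isomorphic S L := by
  have hinv := lie_invariant_of_lieAd_invariant B hB.invariant
  have hH := transport_isHamiltonianLie2Algebra hB.symm hB.pos hinv hk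
  have hS := stringLie2Algebra_isStringLie2Algebra hB.symm hinv (k := k)
  refine ⟨cartanForm B hinv k, cartanForm_isCartanForm hinv,
    ⟨leftInvariantForm_isSmooth _, cartanForm_closed hB.symm hinv,
      cartanForm_nondegenerate hB.pos hinv hk⟩, fun α hα hαL => ?_,
    ⟨_, hS, fun T hT => hT.unique hS⟩, ⟨_, hH, fun M hM => hM.unique hH⟩, fun S L hS' hL => ?_⟩
  · obtain ⟨v, hv⟩ := exists_covector_eq hB.pos hk (α 1)
    refine ⟨hα, mulInvariantVectorField v, ?_⟩
    rw [hαL.eq_leftInvariantForm, ← hv]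
    exact mulInvariantVectorField_isHamiltonian hinv v _ fun w => covector_apply v w
  · rw [hS'.unique hS, hL.unique hH]
    exact Lie2Algebra.isomorphic_transport _ _ _
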